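/- Let $k$ be an algebraically closed field, let $n\ge 2$ and $d\ge 0$ be integers with $\operatorname{char}(k)\nmid (d+1)!$, let $V$ be a $k$-vector space of dimension $n$, and let $S=\operatorname{Sym}V=k[x_1,\dots,x_n]$ with its standard grading. For $f\in S_{d+1}$ let $\langle\nabla f\rangle\subset S_d$ be the span of the partial derivatives $\partial f/\partial x_1,\dots,\partial f/\partial x_n$. For $f\neq 0$ let $\bar f$ be the corresponding point of $\mathbb P S_{d+1}$. Put $$\mathbb P(S_{d+1})^{c}=\{\bar f\in\mathbb P S_{d+1}\mid \dim_k\langle\nabla f\rangle=n\},$$ and let $\nabla\colon \mathbb P(S_{d+1})^{c}\to \operatorname{Grass}(n,S_d)$, $\bar f\mapsto \langle\nabla f\rangle$, be the gradient morphism. A form $f\in S_{d+1}$ is called * *concise* if $f\in\operatorname{Sym}^{d+1}W$ for a subspace $W\subset V$ implies $W=V$; * a *direct sum* if $f=f_1+f_2$ with nonzero $f_1\in \operatorname{Sym}^{d+1}U$ and $f_2\in\operatorname{Sym}^{d+1}W$ for some decomposition $V=U\oplus W$; * *LDS* if, for some basis $x_1,\dots,x_n$ of $V$ and some $\ell$ with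 $1\le \ell\le n/2$, $$f=\sum_{i=1}^{\ell}x_i\,\frac{\partial H(x_{\ell+1},\dots,x_{2\ell})}{\partial x_{\ell+i}}+G(x_{\ell+1},\dots,x_n),$$ where $H$ and $G$ are forms (possibly zero) of degree $d+1$ in $\ell$ and $n-\ell$ variables, respectively; * *GIT semistable* if some homogeneous $\mathrm{SL}(n)$-invariant polynomial function of positive degree on $S_{d+1}$, for the standard action of $\mathrm{SL}(n)$, does not vanish at $f$. **(A)** Suppose $f\in S_{d+1}$ is concise. Then $f\ne0$, $\bar f\in\mathbb P(S_{d+1})^{c}$, and the following are equivalent: 1. $f$ is a direct sum or an LDS form. 2. $\nabla$ is not injective at $\bar f$; that is, there exists $\bar g\in\mathbb P(S_{d+1})^{c}$ with $\bar g\neq\bar f$ and $\nabla \bar f=\nabla \bar g$. 3. $\nabla$ has positive fibre dimension at $\bar f$; that is, the fibre $\nabla^{-1}(\nabla\bar f)$ has dimension $\ge 1$ at $\bar f$ in the Zariski topology. **(B)** Suppose $f\in S_{d+1}$ is GIT semistable. Then $f\neq 0$, $\bar f\in\mathbb P(S_{d+1})^{c}$, and the following are equivalent: 1. $f$ is a direct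 sum. 2. $\nabla$ is not injective at $\bar f$. 3. $\nabla$ has positive fibre dimension at $\bar f$. -/

import Mathlib

open scoped LinearAlgebra.Projectivization Nat

namespace GradientMorphism

/-- The space `S_e` of forms (homogeneous polynomials, including `0`) of degree `e` in
`n` variables over `k`. In particular `Form k n 1` is the space `V` spanned by the variables. -/
abbrev Form (k : Type*) [Field k] (n e : ℕ) : Type _ :=
  ↥(MvPolynomial.homogeneousSubmodule (Fin n) k e)

section Forms

variable {k : Type*} [Field k] {n : ℕ}

/-- For a subspace `W ⊆ V` of linear forms, the subspace `Sym^e W` of the polynomial ring: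
the span of all products of `e` elements of `W`. -/
noncomputable def symPow (W : Submodule k (Form k n 1)) (e : ℕ) : Submodule k (MvPolynomial (Fin n) k) :=
  (W.map (MvPolynomial.homogeneousSubmodule (Fin n) k 1).subtype) ^ e

/-- `f` is concise: it cannot be written as a form in fewer than `n` variables, that is,
`f ∈ Sym^e W` for a subspace `W ⊆ V` implies `W = V`. -/
def IsConcise {e : ℕ} (f : Form k n e) : Prop :=
  ∀ W : Submodule k (Form k n 1), (f : MvPolynomial (Fin n) k) ∈ symPow W e → W = ⊤

/-- `f` is a direct sum: there are a decomposition `V = U ⊕ W` and nonzero `f₁ ∈ Sym^e U`,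
`f₂ ∈ Sym^e W` with `f = f₁ + f₂`. -/
def IsDirectSum {e : ℕ} (f : Form k n e) : Prop :=
  ∃ U W : Submodule k (Form k n 1), IsCompl U W ∧
    ∃ f₁ ∈ symPow U e, ∃ f₂ ∈ symPow W e,
      f₁ ≠ 0 ∧ f₂ ≠ 0 ∧ (f : MvPolynomial (Fin n) k) = f₁ + f₂

/-- `f` is an LDS form: there are `ℓ ≥ 1` and a basis
`x_1, …, x_ℓ, y_1, …, y_ℓ, z_1, …, z_m` of `V` (so that `2 ℓ + m = n`) with
`f = ∑ i, x_i * (∂H/∂y_i)(y) + G(y, z)` for some forms `H`, `G` (possibly zero) of the same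
degree as `f`. -/
def IsLDS {e : ℕ} (f : Form k n e) : Prop :=
  ∃ (l m : ℕ) (b : Module.Basis (Fin l ⊕ (Fin l ⊕ Fin m)) k (Form k n 1))
    (H : MvPolynomial (Fin l) k) (G : MvPolynomial (Fin l ⊕ Fin m) k),
    1 ≤ l ∧ H.IsHomogeneous e ∧ G.IsHomogeneous e ∧
    (f : MvPolynomial (Fin n) k) =
      ∑ i : Fin l, (b (Sum.inl i) : MvPolynomial (Fin n) k) *
          MvPolynomial.aeval
            (fun j : Fin l => (b (Sum.inr (Sum.inl j)) : MvPolynomial (Fin n) k))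
            (MvPolynomial.pderiv i H)
        + MvPolynomial.aeval
            (fun j : Fin l ⊕ Fin m => (b (Sum.inr j) : MvPolynomial (Fin n) k)) G

/-- The partial derivative `∂f/∂x_i ∈ S_d` of a form `f ∈ S_{d+1}`. -/
noncomputable def partialDeriv {d : ℕ} (f : Form k n (d + 1)) (i : Fin n) : Form k n d :=
  ⟨MvPolynomial.pderiv i (f : MvPolynomial (Fin n) k), by
    have h : (f : MvPolynomial (Fin n) k).IsHomogeneous (d + 1) := f.2
    exact h.pderiv⟩

/-- The span `⟨∇f⟩ ⊆ S_d` of the first-order partial derivatives of `f ∈ S_{d+1}`. -/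
noncomputable def gradSpan {d : ℕ} (f : Form k n (d + 1)) : Submodule k (Form k n d) :=
  Submodule.span k (Set.range (partialDeriv f))

/-- The coordinate ring of the vector space `S_e`: polynomials in the coefficients of a form
of degree `e`. -/
abbrev CoordRing (k : Type*) [Field k] (n e : ℕ) : Type _ :=
  MvPolynomial {m : Fin n →₀ ℕ // m.degree = e} k

/-- The value of a polynomial in the coefficients at the form `f`. -/
noncomputable def evalAt {e : ℕ} (F : CoordRing k n e) (f : Form k n e) : k :=
  MvPolynomial.eval (fun m => (f : MvPolynomial (Fin n) k).coeff m.1) F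

/-- The linear substitution `x_i ↦ ∑ j, A j i • x_j` by a matrix, on the polynomial ring. -/
noncomputable def subst (A : Matrix (Fin n) (Fin n) k) :
    MvPolynomial (Fin n) k →ₐ[k] MvPolynomial (Fin n) k :=
  MvPolynomial.aeval (fun i => ∑ j, A j i • MvPolynomial.X j)

/-- `f` is GIT semistable for the standard action of `SL(n)` on `S_e`: some homogeneous
`SL(n)`-invariant polynomial function of positive degree on `S_e` does not vanish at `f`. -/
def IsSemistable {e : ℕ} (f : Form k n e) : Prop :=
  ∃ (r : ℕ) (F : CoordRing k n e), 0 < r ∧ F.IsHomogeneous r ∧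
    (∀ (A : Matrix.SpecialLinearGroup (Fin n) k) (g g' : Form k n e),
      (g' : MvPolynomial (Fin n) k) = subst (A : Matrix (Fin n) (Fin n) k) g →
        evalAt F g' = evalAt F g) ∧
    evalAt F f ≠ 0

end Forms

section Geometry

variable (k : Type*) [Field k] (n : ℕ)

/-- The Zariski topology on (the `k`-points of) the projective space `ℙ S_e`, generated by the
nonvanishing loci of homogeneous polynomials in the coefficients. Nonvanishing of a homogeneous
polynomial does not depend on the representative of a point. -/
instance zariskiTopology (e : ℕ) : TopologicalSpace (ℙ k (Form k n e)) :=
  TopologicalSpace.generateFrom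
    {U | ∃ (r : ℕ) (F : CoordRing k n e), F.IsHomogeneous r ∧
      U = {p : ℙ k (Form k n e) | evalAt F p.rep ≠ 0}}

/-- The locus `(ℙ S_{d+1})^c` of classes of forms with `dim ⟨∇f⟩ = n`, the domain of the
gradient morphism; it carries the subspace topology. The span `⟨∇f⟩` does not change when `f`
is multiplied by a nonzero scalar. -/
def conciseLocus (d : ℕ) : Set (ℙ k (Form k n (d + 1))) :=
  {p | Module.finrank k (gradSpan p.rep) = n}

/-- The Grassmannian (its set of `k`-points) of `r`-dimensional subspaces of `E`. -/
def Grass (r : ℕ) (E : Type*) [AddCommGroup E] [Module k E] : Type _ :=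
  {W : Submodule k E // Module.finrank k W = r}

variable {k n}

/-- The gradient morphism `∇ : (ℙ S_{d+1})^c → Grass(n, S_d)`, sending the class of `f`
to `⟨∇f⟩`. -/
noncomputable def nabla {d : ℕ} (p : conciseLocus k n d) : Grass k n (Form k n d) :=
  ⟨gradSpan p.1.rep, p.2⟩

/-- The dimension at the point `x` of a subset `Z` (with the subspace topology) of a topological
space: the infimum of the Krull dimensions of the open neighbourhoods of `x` in `Z`. -/
noncomputable def dimAt {X : Type*} [TopologicalSpace X] (Z : Set X) (x : X) : WithBot ℕ∞ :=
  ⨅ (U : Set X) (_ : IsOpen U) (_ : x ∈ U), topologicalKrullDim ↥(Z ∩ U)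

/-- `∇` is not injective at `p`: another point has the same image. -/
def NotInjectiveAt {d : ℕ} (p : conciseLocus k n d) : Prop :=
  ∃ q : conciseLocus k n d, q ≠ p ∧ nabla p = nabla q

/-- `∇` has positive fibre dimension at `p`: the fibre through `p` has dimension at least `1`
at `p`. -/
def PositiveFibreDimAt {d : ℕ} (p : conciseLocus k n d) : Prop :=
  1 ≤ dimAt (nabla ⁻¹' {nabla p}) p

end Geometry

end GradientMorphism

/-! Derivatives are indexed without coordinates by functionals `u` on linear forms. If `g` has the
same gradient span as `f`, each derivative of `g` is a derivative of `f`, so `∂_u g = ∂_{u ∘ T} f`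
for an endomorphism `T` of `V`, scalar only if `g` is a multiple of `f`
(`hasGradientPartner_of_gradSpan_eq`). Everything is read off from such a pair
(`HasGradientPartner`).

Symmetry of second derivatives makes `T` self-adjoint for the Hessian of `f`, and so is every
polynomial in `T`. Over an algebraically closed field a non-scalar `T` has a polynomial in it that
is either a nontrivial idempotent or nonzero of square zero (`exists_aeval_idempotent_or_sq_zero`).
A self-adjoint idempotent makes mixed derivatives vanish and splits a concise `f` into a direct sum;
a self-adjoint square-zero map forces the LDS shape. Conversely both shapes exhibit a partner `h` of
`f`.

With a partner `h`, the pencil `f + t h` has gradient `∂_{u ∘ (1 + t T)} f`. For all but finitely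
many `t` the span is unchanged, so the fibre contains a curve through the class of `f`; and a fibre
of positive dimension is not a single point. This closes the cycle in (A).

For (B), a one-parameter subgroup giving all monomials of `f` positive weight sends `f` to `0`,
which semistability forbids (`IsSemistable.exists_weight_nonpos`). Suitable weights show that
semistable forms are concise and, for `d ≥ 2`, not LDS. For `d = 0` no concise form exists, and for
`d = 1` every concise quadric is a direct sum. -/

namespace GradientMorphism

open MvPolynomial

/-! ### Directional derivatives and changes of basis -/

section DirectionalDerivative

variable {k : Type*} [Field k] {n : ℕ}

/-- The variable `x_i` as a linear form. -/
noncomputable def varForm (i : Fin n) : Form k n 1 := ⟨X i, isHomogeneous_X k i⟩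

/-- The basis of the space of linear forms given by the variables. -/
noncomputable def varBasis (k : Type*) [Field k] (n : ℕ) :
    Module.Basis (Fin n) k (Form k n 1) :=
  Module.Basis.mk (v := varForm)
    (by
      have h : LinearIndependent k
          ((homogeneousSubmodule (Fin n) k 1).subtype ∘ (varForm : Fin n → Form k n 1)) :=
        linearIndependent_X (Fin n) k
      exact h.of_comp _)
    (by
      rintro ⟨p, hp⟩ -
      have h := hp
      rw [homogeneousSubmodule_one_eq_span_X] at h
      have h2 : Submodule.map (homogeneousSubmodule (Fin n) k 1).subtype
          (Submodule.span k (Set.range varForm)) = Submodule.span k (Set.range X) := by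
        rw [Submodule.map_span, ← Set.range_comp]
        rfl
      rw [← h2] at h
      obtain ⟨q, hq, rfl⟩ := h
      exact hq)

@[simp]
theorem varBasis_apply (i : Fin n) : varBasis k n i = varForm i := by
  simp [varBasis]

instance : Module.Finite k (Form k n 1) := Module.Finite.of_basis (varBasis k n)

theorem finrank_linearForm : Module.finrank k (Form k n 1) = n := by
  simpa using Module.finrank_eq_card_basis (varBasis k n)

/-- The derivation of the polynomial ring that extends a linear functional on linear forms. -/
noncomputable def dirDeriv : Module.Dual k (Form k n 1) →ₗ[k]
    Derivation k (MvPolynomial (Fin n) k) (MvPolynomial (Fin n) k) where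
  toFun u := mkDerivation k fun i => C (u (varForm i))
  map_add' u Ψ := by ext i; simp
  map_smul' c u := by ext i; simp [smul_eq_C_mul]

@[simp]
theorem dirDeriv_X (u : Module.Dual k (Form k n 1)) (i : Fin n) :
    dirDeriv u (X i) = C (u (varForm i)) := by
  simp [dirDeriv]

theorem dirDeriv_linearForm (u : Module.Dual k (Form k n 1)) (a : Form k n 1) :
    dirDeriv u (a : MvPolynomial (Fin n) k) = C (u a) := by
  have h : (dirDeriv u).toLinearMap ∘ₗ (homogeneousSubmodule (Fin n) k 1).subtype =
      (Algebra.linearMap k (MvPolynomial (Fin n) k)) ∘ₗ u := by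
    refine (varBasis k n).ext fun i => ?_
    simp [varForm, algebraMap_eq]
  exact LinearMap.congr_fun h a

theorem dirDeriv_comm (u Ψ : Module.Dual k (Form k n 1)) (f : MvPolynomial (Fin n) k) :
    dirDeriv u (dirDeriv Ψ f) = dirDeriv Ψ (dirDeriv u f) := by
  have h : ⁅dirDeriv u, dirDeriv Ψ⁆ = 0 := by
    ext i
    simp [Derivation.commutator_apply]
  have h2 := DFunLike.congr_fun h f
  rw [Derivation.commutator_apply] at h2
  exact sub_eq_zero.mp h2

theorem dirDeriv_aeval {ι : Type*} [Fintype ι] (b : ι → Form k n 1)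
    (u : Module.Dual k (Form k n 1)) (p : MvPolynomial ι k) :
    dirDeriv u (aeval (fun i => (b i : MvPolynomial (Fin n) k)) p) =
      ∑ i, u (b i) • aeval (fun i => (b i : MvPolynomial (Fin n) k)) (pderiv i p) := by
  classical
  induction p using MvPolynomial.induction_on with
  | C a => simp
  | add p q hp hq => simp only [map_add, hp, hq, smul_add, Finset.sum_add_distrib]
  | mul_X p j hp =>
    simp only [map_mul, aeval_X, Derivation.leibniz, dirDeriv_linearForm, hp, pderiv_X,
      smul_eq_mul, map_add, smul_add, Finset.sum_add_distrib, Finset.mul_sum]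
    congr 1
    · simp [Pi.single_apply, apply_ite, smul_eq_C_mul, mul_comm]
    · refine Finset.sum_congr rfl fun i _ => ?_
      rw [mul_smul_comm]

/-- Dual coordinates differentiate as partials in the adapted variables. With
`aeval_basis_injective`, this transfers vanishing of derivatives of `f` to its coordinate polynomial
`p`. -/
theorem dirDeriv_coord_aeval {ι : Type*} [Fintype ι] (b : Module.Basis ι k (Form k n 1))
    (i : ι) (p : MvPolynomial ι k) :
    dirDeriv (b.coord i) (aeval (fun i => (b i : MvPolynomial (Fin n) k)) p) =
      aeval (fun i => (b i : MvPolynomial (Fin n) k)) (pderiv i p) := by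
  classical
  rw [dirDeriv_aeval, Finset.sum_eq_single i]
  · simp
  · intro j _ hj
    simp [hj]
  · simp

theorem dirDeriv_eq_sum (u : Module.Dual k (Form k n 1)) (f : MvPolynomial (Fin n) k) :
    dirDeriv u f = ∑ i, u (varForm i) • pderiv i f := by
  have h := dirDeriv_aeval (varForm : Fin n → Form k n 1) u f
  simpa [varForm, aeval_X_left] using h

theorem isHomogeneous_dirDeriv {d : ℕ} {f : MvPolynomial (Fin n) k}
    (hf : f.IsHomogeneous (d + 1)) (u : Module.Dual k (Form k n 1)) :
    (dirDeriv u f).IsHomogeneous d := by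
  rw [dirDeriv_eq_sum]
  refine IsHomogeneous.sum _ _ _ fun i _ => ?_
  rw [smul_eq_C_mul]
  exact IsHomogeneous.C_mul hf.pderiv _

theorem aeval_basis_injective {ι : Type*} [Fintype ι] (b : Module.Basis ι k (Form k n 1)) :
    Function.Injective
      (aeval (fun i => (b i : MvPolynomial (Fin n) k)) : MvPolynomial ι k →ₐ[k] _) := by
  let Ψ : MvPolynomial (Fin n) k →ₐ[k] MvPolynomial ι k :=
    aeval fun j => ∑ i, b.repr (varForm j) i • X i
  have hΨ : ∀ a : Form k n 1, Ψ (a : MvPolynomial (Fin n) k) = ∑ i, b.repr a i • X i := by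
    intro a
    let θ : Form k n 1 →ₗ[k] MvPolynomial ι k := ∑ i, (b.coord i).smulRight (X i)
    have hθ : Ψ.toLinearMap ∘ₗ (homogeneousSubmodule (Fin n) k 1).subtype = θ := by
      refine (varBasis k n).ext fun i => ?_
      simp [θ, Ψ, varForm]
    simpa [θ] using LinearMap.congr_fun hθ a
  have h : Ψ.comp (aeval (fun i => (b i : MvPolynomial (Fin n) k))) = AlgHom.id k _ := by
    classical
    ext1 i
    simp [hΨ, Finsupp.single_apply]
  intro p q hpq
  have := congrArg Ψ hpq
  have e : ∀ p, Ψ (aeval (fun i => (b i : MvPolynomial (Fin n) k)) p) = p :=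
    fun p => AlgHom.congr_fun h p
  rwa [e, e] at this

theorem exists_aeval_basis {ι : Type*} [Fintype ι] (b : Module.Basis ι k (Form k n 1))
    {e : ℕ} {f : MvPolynomial (Fin n) k} (hf : f.IsHomogeneous e) :
    ∃ p : MvPolynomial ι k, p.IsHomogeneous e ∧
      aeval (fun i => (b i : MvPolynomial (Fin n) k)) p = f := by
  refine ⟨aeval (fun j => ∑ i, b.repr (varForm j) i • X i) f, ?_, ?_⟩
  · have h := hf.aeval (fun j => ∑ i, b.repr (varForm j) i • X (R := k) i) (n := 1) fun j =>
      IsHomogeneous.sum _ _ _ fun i _ => by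
        rw [smul_eq_C_mul]
        exact isHomogeneous_C_mul_X _ _
    simpa using h
  · rw [← AlgHom.comp_apply]
    conv_rhs => rw [← AlgHom.id_apply (R := k) f]
    congr 1
    ext1 j
    have h : ((∑ i, b.repr (varForm j) i • b i : Form k n 1) : MvPolynomial (Fin n) k) = X j := by
      rw [b.sum_repr]; rfl
    rw [AddSubmonoidClass.coe_finsetSum] at h
    simpa using h

theorem isHomogeneous_aeval_linearForm {ι : Type*} (b : ι → Form k n 1) {e : ℕ}
    {p : MvPolynomial ι k} (hp : p.IsHomogeneous e) :
    (aeval (fun i => (b i : MvPolynomial (Fin n) k)) p).IsHomogeneous e := by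
  simpa using hp.aeval (fun i => (b i : MvPolynomial (Fin n) k)) fun i => (b i).2

theorem prod_mem_prod_submodule {R A ι : Type*} [CommSemiring R] [CommSemiring A] [Algebra R A]
    (s : Finset ι) (M : ι → Submodule R A) (x : ι → A) (h : ∀ i ∈ s, x i ∈ M i) :
    ∏ i ∈ s, x i ∈ ∏ i ∈ s, M i := by
  classical
  induction s using Finset.induction_on with
  | empty => simpa using Submodule.one_le.mp (le_refl (1 : Submodule R A))
  | insert a s ha ih =>
    rw [Finset.prod_insert ha, Finset.prod_insert ha]
    exact Submodule.mul_mem_mul (h a (by simp)) (ih fun i hi => h i (by simp [hi]))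

theorem aeval_mem_symPow {ι : Type*} {b : ι → Form k n 1} {W : Submodule k (Form k n 1)}
    {e : ℕ} {p : MvPolynomial ι k} (hp : p.IsHomogeneous e)
    (hb : ∀ m ∈ p.support, ∀ i, m i ≠ 0 → b i ∈ W) :
    aeval (fun i => (b i : MvPolynomial (Fin n) k)) p ∈ symPow W e := by
  rw [aeval_def, eval₂_eq]
  refine Submodule.sum_mem _ fun m hm => ?_
  rw [algebraMap_eq, ← smul_eq_C_mul]
  refine Submodule.smul_mem _ _ ?_
  have he : ∑ i ∈ m.support, m i = e := (hp.degree_eq_sum_deg_support hm).symm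
  rw [symPow, ← he, ← Finset.prod_pow_eq_pow_sum]
  refine prod_mem_prod_submodule _ _ _ fun i hi => Submodule.pow_mem_pow _ ?_ _
  exact Submodule.mem_map_of_mem (hb m hm i (Finsupp.mem_support_iff.mp hi))

theorem dirDeriv_eq_zero_of_mem_symPow {W : Submodule k (Form k n 1)} {e : ℕ}
    {f : MvPolynomial (Fin n) k} (hf : f ∈ symPow W e) {u : Module.Dual k (Form k n 1)}
    (hu : ∀ a ∈ W, u a = 0) : dirDeriv u f = 0 := by
  induction hf using Submodule.pow_induction_on_left' with
  | algebraMap r => simp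
  | add x y i hx hy h1 h2 => rw [map_add, h1, h2, add_zero]
  | mem_mul m hm i x hx h =>
    obtain ⟨a, ha, rfl⟩ := hm
    simp [h, dirDeriv_linearForm, hu a ha]

theorem symPow_le_homogeneousSubmodule (W : Submodule k (Form k n 1)) (e : ℕ) :
    symPow W e ≤ homogeneousSubmodule (Fin n) k e := by
  rw [← homogeneousSubmodule_one_pow, symPow]
  exact pow_le_pow_left' (by rintro _ ⟨a, -, rfl⟩; exact a.2) _

end DirectionalDerivative

/-! ### Vanishing derivatives and supports of forms -/

section Support

variable {k : Type*} [Field k] {σ : Type*}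

theorem natCast_ne_zero_of_ringChar_not_dvd {d : ℕ} (hchar : ¬ ringChar k ∣ (d + 1)!) {m : ℕ}
    (hm : 0 < m) (hmd : m ≤ d + 1) : (m : k) ≠ 0 := fun h =>
  hchar (((ringChar.spec k m).mp h).trans (Nat.dvd_factorial hm hmd))

/-- Differentiation multiplies the coefficient of `m` by the exponent `m i`, which is invertible
whenever `0 < m i ≤ e`. -/
theorem apply_eq_zero_of_pderiv_eq_zero {e : ℕ} (he : ∀ m : ℕ, 0 < m → m ≤ e → (m : k) ≠ 0)
    {p : MvPolynomial σ k} (hp : p.IsHomogeneous e) {i : σ} (h : pderiv i p = 0)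
    {m : σ →₀ ℕ} (hm : m ∈ p.support) : m i = 0 := by
  by_contra hi
  have hsum : m.degree = e := by
    by_contra hne
    exact mem_support_iff.mp hm (hp.coeff_eq_zero hne)
  have hle : m i ≤ e := hsum ▸ Finsupp.le_degree i m
  have h1 := coeff_pderiv (i := i) p (m - Finsupp.single i 1)
  have h2 : m - Finsupp.single i 1 + Finsupp.single i 1 = m :=
    tsub_add_cancel_of_le (by simpa using Nat.one_le_iff_ne_zero.mpr hi)
  have h3 : (((m - Finsupp.single i 1 : σ →₀ ℕ) i : ℕ) : k) + 1 = (m i : k) := by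
    rw [← Nat.cast_succ]
    congr 1
    simp
    omega
  rw [h, h2, h3, coeff_zero] at h1
  rcases mul_eq_zero.mp h1.symm with h4 | h4
  · exact mem_support_iff.mp hm h4
  · exact he _ (Nat.pos_of_ne_zero hi) hle h4

theorem apply_eq_zero_or_of_pderiv_pderiv_eq_zero {e : ℕ}
    (he : ∀ m : ℕ, 0 < m → m ≤ e → (m : k) ≠ 0)
    {p : MvPolynomial σ k} (hp : p.IsHomogeneous e) {i j : σ} (hij : i ≠ j)
    (h : pderiv i (pderiv j p) = 0) {m : σ →₀ ℕ} (hm : m ∈ p.support) : m i = 0 ∨ m j = 0 := by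
  by_contra! hne
  obtain ⟨hi, hj⟩ := hne
  have hsum : m.degree = e := by
    by_contra hne
    exact mem_support_iff.mp hm (hp.coeff_eq_zero hne)
  have hle : m j ≤ e := hsum ▸ Finsupp.le_degree j m
  have h1 := coeff_pderiv (i := j) p (m - Finsupp.single j 1)
  have h2 : m - Finsupp.single j 1 + Finsupp.single j 1 = m :=
    tsub_add_cancel_of_le (by simpa using Nat.one_le_iff_ne_zero.mpr hj)
  have h3 : (((m - Finsupp.single j 1 : σ →₀ ℕ) j : ℕ) : k) + 1 = (m j : k) := by
    rw [← Nat.cast_succ]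
    congr 1
    simp
    omega
  rw [h2, h3] at h1
  have hmem : m - Finsupp.single j 1 ∈ (pderiv j p).support := by
    rw [mem_support_iff, h1]
    exact mul_ne_zero (mem_support_iff.mp hm) (he _ (Nat.pos_of_ne_zero hj) hle)
  have h4 := apply_eq_zero_of_pderiv_eq_zero (e := e - 1)
    (fun m h0 hm => he m h0 (hm.trans (Nat.sub_le _ _))) hp.pderiv h hmem
  simp [hij.symm, hi] at h4

end Support

/-! ### Bases adapted to a decomposition -/

section AdaptedBasis

variable {k V : Type*} [Field k] [AddCommGroup V] [Module k V] [Module.Finite k V]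
  {U W : Submodule k V}

/-- A basis of the space formed by bases of two complementary subspaces. -/
noncomputable def isComplBasis (h : IsCompl U W) :
    Module.Basis (Fin (Module.finrank k U) ⊕ Fin (Module.finrank k W)) k V :=
  ((Module.finBasis k U).prod (Module.finBasis k W)).map (Submodule.prodEquivOfIsCompl U W h)

theorem isComplBasis_inl_mem (h : IsCompl U W) (i) : isComplBasis h (Sum.inl i) ∈ U := by
  simp [isComplBasis]

theorem isComplBasis_inr_mem (h : IsCompl U W) (i) : isComplBasis h (Sum.inr i) ∈ W := by
  simp [isComplBasis]

theorem isComplBasis_coord_inr (h : IsCompl U W) (j) {a : V} (ha : a ∈ U) :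
    (isComplBasis h).coord (Sum.inr j) a = 0 := by
  simp [isComplBasis, (Submodule.projectionOnto_apply_eq_zero_iff h.symm).mpr ha]

theorem isComplBasis_coord_inl (h : IsCompl U W) (j) {a : V} (ha : a ∈ W) :
    (isComplBasis h).coord (Sum.inl j) a = 0 := by
  simp [isComplBasis, (Submodule.projectionOnto_apply_eq_zero_iff h).mpr ha]

end AdaptedBasis

/-! ### Concise forms have independent derivatives -/

section Concise

variable {k : Type*} [Field k] {n : ℕ}

theorem eq_zero_of_dirDeriv_eq_zero {e : ℕ} (he : (e : k) ≠ 0) {f : MvPolynomial (Fin n) k}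
    (hf : f.IsHomogeneous e) (h : ∀ u, dirDeriv u f = 0) : f = 0 := by
  have h1 := hf.sum_X_mul_pderiv
  have h2 : ∀ i, pderiv i f = 0 := fun i => by
    have := h ((varBasis k n).coord i)
    rw [dirDeriv_eq_sum, Finset.sum_eq_single i] at this
    · simpa [← varBasis_apply] using this
    · intro j _ hj
      simp [← varBasis_apply, hj]
    · simp
  simp only [h2, mul_zero, Finset.sum_const_zero] at h1
  rw [← Nat.cast_smul_eq_nsmul k] at h1
  exact (smul_eq_zero.mp h1.symm).resolve_left he

/-- In a basis adapted to `ker u` and a complement, the complementary coordinates are multiples of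
`u`. If `∂_u f = 0`, those variables do not occur, so `f ∈ Sym^e (ker u)` and conciseness gives `ker
u = V`. -/
theorem IsConcise.dirDeriv_ne_zero {e : ℕ} (he : ∀ m : ℕ, 0 < m → m ≤ e → (m : k) ≠ 0)
    {f : Form k n e} (hf : IsConcise f) {u : Module.Dual k (Form k n 1)}
    (hu : dirDeriv u (f : MvPolynomial (Fin n) k) = 0) : u = 0 := by
  by_contra hne
  obtain ⟨a, ha⟩ : ∃ a, u a ≠ 0 := by
    by_contra! h
    exact hne (LinearMap.ext h)
  obtain ⟨C, hC⟩ := Submodule.exists_isCompl (LinearMap.ker u)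
  let b := isComplBasis hC
  obtain ⟨p, hp, hpf⟩ := exists_aeval_basis b f.2
  have hco : ∀ j, b.coord (Sum.inr j) = (b.coord (Sum.inr j) a / u a) • u := by
    intro j
    ext x
    have hx : x - (u x / u a) • a ∈ LinearMap.ker u := by
      simp [ha]
    have h := isComplBasis_coord_inr hC j hx
    rw [map_sub, map_smul, sub_eq_zero] at h
    change b.coord (Sum.inr j) x = (u x / u a) • b.coord (Sum.inr j) a at h
    rw [h]
    simp only [smul_eq_mul, LinearMap.smul_apply]
    ring
  have hpd : ∀ j, pderiv (Sum.inr j) p = 0 := by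
    intro j
    apply aeval_basis_injective b
    rw [← dirDeriv_coord_aeval, hpf, hco, map_smul, Derivation.smul_apply, hu, smul_zero, map_zero]
  have hmem : (f : MvPolynomial (Fin n) k) ∈ symPow (LinearMap.ker u) e := by
    rw [← hpf]
    refine aeval_mem_symPow hp fun m hm i hi => ?_
    rcases i with i | j
    · exact isComplBasis_inl_mem hC i
    · exact absurd (apply_eq_zero_of_pderiv_eq_zero he hp (hpd j) hm) hi
  exact ha (LinearMap.ext_iff.mp (LinearMap.ker_eq_top.mp (hf _ hmem)) a)

end Concise

/-! ### Partners of direct sums and LDS forms -/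

section GradientPartner

variable {k : Type*} [Field k] {n : ℕ}

/-- There is a form `h` whose gradient is obtained from the gradient of `f` by a non-scalar
endomorphism of the space of linear forms. -/
def HasGradientPartner {e : ℕ} (f : Form k n e) : Prop :=
  ∃ (h : Form k n e) (T : Module.End k (Form k n 1)),
    (∀ u : Module.Dual k (Form k n 1), dirDeriv u (h : MvPolynomial (Fin n) k) =
      dirDeriv (u ∘ₗ T) (f : MvPolynomial (Fin n) k)) ∧ ∀ c : k, T ≠ c • LinearMap.id

theorem ne_bot_of_mem_symPow {e : ℕ} {W : Submodule k (Form k n 1)} {f : MvPolynomial (Fin n) k}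
    (hf : f ∈ symPow W (e + 1)) (h0 : f ≠ 0) : W ≠ ⊥ := by
  rintro rfl
  rw [symPow, Submodule.map_bot, Submodule.bot_pow (Nat.succ_ne_zero e)] at hf
  exact h0 hf

/-- The partner is `f₂`, with `T` the projection onto `W` along `U`: `u ∘ T` vanishes on `U` and
agrees with `u` on `W`. -/
theorem IsDirectSum.hasGradientPartner {e : ℕ} {f : Form k n (e + 1)} (hf : IsDirectSum f) :
    HasGradientPartner f := by
  obtain ⟨U, W, hUW, f₁, hf₁, f₂, hf₂, h₁, h₂, hsum⟩ := hf
  let T : Module.End k (Form k n 1) := W.projection U hUW.symm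
  have hTU : ∀ a ∈ U, T a = 0 := fun a ha =>
    (Submodule.projection_apply_eq_zero_iff hUW.symm).mpr ha
  have hTW : ∀ a ∈ W, T a = a := fun a ha => Submodule.projection_apply_left hUW.symm ⟨a, ha⟩
  refine ⟨⟨f₂, symPow_le_homogeneousSubmodule _ _ hf₂⟩, T, fun u => ?_, fun c hc => ?_⟩
  · have e1 : dirDeriv (u ∘ₗ T) f₁ = 0 :=
      dirDeriv_eq_zero_of_mem_symPow hf₁ fun a ha => by simp [hTU a ha]
    have e2 : dirDeriv (u - u ∘ₗ T) f₂ = 0 :=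
      dirDeriv_eq_zero_of_mem_symPow hf₂ fun a ha => by simp [hTW a ha]
    rw [map_sub, Derivation.sub_apply, sub_eq_zero] at e2
    rw [hsum, map_add, e1, zero_add, ← e2]
  · obtain ⟨x, hx, hx0⟩ := U.ne_bot_iff.mp (ne_bot_of_mem_symPow hf₁ h₁)
    obtain ⟨y, hy, hy0⟩ := W.ne_bot_iff.mp (ne_bot_of_mem_symPow hf₂ h₂)
    have e1 := hTU x hx
    have e2 := hTW y hy
    simp only [hc, LinearMap.smul_apply, LinearMap.id_apply] at e1 e2
    have hc0 : c = 0 := (smul_eq_zero.mp e1).resolve_right hx0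
    rw [hc0, zero_smul] at e2
    exact hy0 e2.symm

/-- The partner is `H(y)`, with `T` sending `x_i` to `y_i` and killing all `y` and `z`: both
derivatives equal `∑ u(y_i) (∂H/∂y_i)(y)`. -/
theorem IsLDS.hasGradientPartner {e : ℕ} {f : Form k n e} (hf : IsLDS f) :
    HasGradientPartner f := by
  obtain ⟨l, m, b, H, G, hl, hH, hG, hfe⟩ := hf
  let T : Module.End k (Form k n 1) :=
    b.constr k (Sum.elim (fun i => b (Sum.inr (Sum.inl i))) fun _ => 0)
  have hTx : ∀ i, T (b (Sum.inl i)) = b (Sum.inr (Sum.inl i)) := fun i => by simp [T]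
  have hTy : ∀ j, T (b (Sum.inr j)) = 0 := fun j => by simp [T]
  refine ⟨⟨_, isHomogeneous_aeval_linearForm (fun j : Fin l => b (Sum.inr (Sum.inl j))) hH⟩, T,
    fun u => ?_, fun c hc => ?_⟩
  · rw [hfe, map_add, map_sum,
      dirDeriv_aeval (fun j : Fin l ⊕ Fin m => b (Sum.inr j))]
    simp only [Derivation.leibniz, dirDeriv_linearForm, LinearMap.comp_apply, hTy, hTx,
      map_zero, zero_smul, Finset.sum_const_zero, add_zero]
    rw [dirDeriv_aeval]
    refine Finset.sum_congr rfl fun i _ => ?_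
    rw [dirDeriv_aeval (fun j : Fin l => b (Sum.inr (Sum.inl j)))]
    simp [hTy, smul_eq_C_mul, mul_comm]
  · have e1 := hTx ⟨0, hl⟩
    have e2 := hTy (Sum.inl ⟨0, hl⟩)
    simp only [hc, LinearMap.smul_apply, LinearMap.id_apply] at e1 e2
    have hc0 : c = 0 := (smul_eq_zero.mp e2).resolve_right (b.ne_zero _)
    rw [hc0, zero_smul] at e1
    exact b.ne_zero _ e1.symm

end GradientPartner

/-! ### The gradient span as the image of a linear map -/

section GradientSpan

variable {k : Type*} [Field k] {n d : ℕ}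

/-- The directional derivatives of a form, as a linear map on functionals. -/
noncomputable def gradMap (f : Form k n (d + 1)) :
    Module.Dual k (Form k n 1) →ₗ[k] Form k n d where
  toFun u := ⟨dirDeriv u (f : MvPolynomial (Fin n) k), isHomogeneous_dirDeriv f.2 u⟩
  map_add' u v := by ext1; simp
  map_smul' c u := by ext1; simp

@[simp]
theorem coe_gradMap (f : Form k n (d + 1)) (u : Module.Dual k (Form k n 1)) :
    (gradMap f u : MvPolynomial (Fin n) k) = dirDeriv u (f : MvPolynomial (Fin n) k) := rfl

theorem gradSpan_eq_range (f : Form k n (d + 1)) : gradSpan f = LinearMap.range (gradMap f) := by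
  rw [LinearMap.range_eq_map, ← (varBasis k n).dualBasis.span_eq, Submodule.map_span,
    ← Set.range_comp]
  unfold gradSpan
  congr 2
  ext1 i
  ext1
  simp only [Function.comp_apply, coe_gradMap, dirDeriv_eq_sum]
  rw [Finset.sum_eq_single i]
  · simp [← varBasis_apply, partialDeriv]
  · intro j _ hj
    simp [← varBasis_apply, hj]
  · simp

theorem gradMap_smul (c : k) (f : Form k n (d + 1)) : gradMap (c • f) = c • gradMap f := by
  ext u : 1
  ext1
  simp

theorem gradSpan_smul {c : k} (hc : c ≠ 0) (f : Form k n (d + 1)) :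
    gradSpan (c • f) = gradSpan f := by
  rw [gradSpan_eq_range, gradSpan_eq_range, gradMap_smul, LinearMap.range_smul _ _ hc]

theorem gradSpan_rep (f : Form k n (d + 1)) (hf : f ≠ 0) :
    gradSpan (Projectivization.mk k f hf).rep = gradSpan f := by
  obtain ⟨a, ha⟩ := Projectivization.exists_smul_eq_mk_rep k f hf
  rw [← ha]
  exact gradSpan_smul a.ne_zero f

theorem finrank_gradSpan_eq_iff (f : Form k n (d + 1)) :
    Module.finrank k (gradSpan f) = n ↔ Function.Injective (gradMap f) := by
  have hn : Module.finrank k (Module.Dual k (Form k n 1)) = n := by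
    rw [Subspace.dual_finrank_eq, finrank_linearForm]
  rw [gradSpan_eq_range]
  constructor
  · intro h
    have := LinearMap.finrank_range_add_finrank_ker (gradMap f)
    rw [h, hn] at this
    rw [← LinearMap.ker_eq_bot, ← Submodule.finrank_eq_zero (R := k)]
    omega
  · intro h
    rw [LinearMap.finrank_range_of_inj h, hn]

theorem mk_mem_conciseLocus_iff (f : Form k n (d + 1)) (hf : f ≠ 0) :
    Projectivization.mk k f hf ∈ conciseLocus k n d ↔ Function.Injective (gradMap f) := by
  rw [← finrank_gradSpan_eq_iff, ← gradSpan_rep f hf]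
  rfl

theorem nabla_mk_eq_iff {f g : Form k n (d + 1)} (hf : f ≠ 0) (hg : g ≠ 0)
    (hf' : Projectivization.mk k f hf ∈ conciseLocus k n d)
    (hg' : Projectivization.mk k g hg ∈ conciseLocus k n d) :
    nabla ⟨_, hf'⟩ = nabla ⟨_, hg'⟩ ↔ gradSpan f = gradSpan g := by
  rw [← gradSpan_rep f hf, ← gradSpan_rep g hg]
  exact Subtype.ext_iff

theorem gradSpan_eq_of_dirDeriv {f g : Form k n (d + 1)} {T : Module.End k (Form k n 1)}
    (hT : Function.Injective T)
    (h : ∀ u : Module.Dual k (Form k n 1), dirDeriv u (g : MvPolynomial (Fin n) k) =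
      dirDeriv (u ∘ₗ T) (f : MvPolynomial (Fin n) k)) : gradSpan g = gradSpan f := by
  have h1 : gradMap g = gradMap f ∘ₗ T.dualMap := by
    ext u : 1
    ext1
    exact h u
  rw [gradSpan_eq_range, gradSpan_eq_range, h1, LinearMap.range_comp,
    LinearMap.range_eq_top.mpr (LinearMap.dualMap_surjective_of_injective hT), Submodule.map_top]

end GradientSpan

/-! ### The Zariski topology on forms -/

section Zariski

variable {k : Type*} [Field k] {n e : ℕ}

theorem evalAt_smul {r : ℕ} {F : CoordRing k n e} (hF : F.IsHomogeneous r) (c : k)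
    (f : Form k n e) : evalAt F (c • f) = c ^ r * evalAt F f := by
  simp only [evalAt, eval_eq, Finset.mul_sum]
  refine Finset.sum_congr rfl fun m hm => ?_
  have hr : ∑ i ∈ m.support, m i = r := (hF.degree_eq_sum_deg_support hm).symm
  rw [← hr, ← Finset.prod_pow_eq_pow_sum]
  simp only [Submodule.coe_smul, coeff_smul, smul_eq_mul, mul_pow, Finset.prod_mul_distrib]
  ring

theorem evalAt_rep_ne_zero_iff {r : ℕ} {F : CoordRing k n e} (hF : F.IsHomogeneous r)
    (f : Form k n e) (hf : f ≠ 0) :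
    evalAt F (Projectivization.mk k f hf).rep ≠ 0 ↔ evalAt F f ≠ 0 := by
  obtain ⟨a, ha⟩ := Projectivization.exists_smul_eq_mk_rep k f hf
  rw [← ha]
  change evalAt F ((a : k) • f) ≠ 0 ↔ _
  rw [evalAt_smul hF]
  simp

/-- If all 2×2 minors of two coefficient vectors vanish, the vectors are proportional. A nonzero
minor, with the entries of `q` fixed, is a linear form vanishing at `q` but not at `p`. -/
instance : T1Space (ℙ k (Form k n e)) := by
  rw [t1Space_iff_exists_open]
  intro p q hpq
  obtain ⟨m, m', hm⟩ : ∃ m m' : {m : Fin n →₀ ℕ // m.degree = e},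
      (p.rep : MvPolynomial (Fin n) k).coeff m.1 * (q.rep : MvPolynomial (Fin n) k).coeff m'.1 ≠
      (p.rep : MvPolynomial (Fin n) k).coeff m'.1 * (q.rep : MvPolynomial (Fin n) k).coeff m.1 := by
    by_contra! h
    have hq0 : (q.rep : MvPolynomial (Fin n) k) ≠ 0 := by
      simpa using q.rep_nonzero
    obtain ⟨m', hm'⟩ := ne_zero_iff.mp hq0
    have hdeg : ∀ f : Form k n e, ∀ m : Fin n →₀ ℕ,
        (f : MvPolynomial (Fin n) k).coeff m ≠ 0 → m.degree = e := fun f m h => by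
      by_contra hne
      exact h (IsHomogeneous.coeff_eq_zero f.2 hne)
    have hc : ((p.rep : MvPolynomial (Fin n) k).coeff m' /
        (q.rep : MvPolynomial (Fin n) k).coeff m') • q.rep = p.rep := by
      ext m
      by_cases hm : m.degree = e
      · have := h ⟨m, hm⟩ ⟨m', hdeg _ _ hm'⟩
        simp only at this
        simp only [Submodule.coe_smul, coeff_smul, smul_eq_mul]
        field_simp
        linear_combination -this
      · have h1 := mt (hdeg p.rep m) hm
        have h2 := mt (hdeg q.rep m) hm
        rw [not_not] at h1 h2
        simp [h1, h2]
    refine hpq ?_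
    rw [← p.mk_rep, ← q.mk_rep, Projectivization.mk_eq_mk_iff']
    exact ⟨_, hc⟩
  let F : CoordRing k n e := C ((q.rep : MvPolynomial (Fin n) k).coeff m'.1) * X m -
    C ((q.rep : MvPolynomial (Fin n) k).coeff m.1) * X m'
  have hF : F.IsHomogeneous 1 := (isHomogeneous_C_mul_X _ _).sub (isHomogeneous_C_mul_X _ _)
  refine ⟨{x | evalAt F x.rep ≠ 0}, TopologicalSpace.isOpen_generateFrom_of_mem ⟨1, F, hF, rfl⟩,
    ?_, ?_⟩
  · simp only [Set.mem_ofPred_eq, evalAt, F, map_sub, map_mul, eval_C, eval_X]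
    rw [sub_ne_zero]
    rwa [mul_comm, mul_comm (coeff m.1 (q.rep : MvPolynomial (Fin n) k))]
  · simp [evalAt, F, mul_comm]

/-- Restricted to a line, `F` becomes a one-variable polynomial in `t`, with finitely many roots
unless it is zero. -/
theorem finite_compl_evalAt_add_smul_ne_zero (F : CoordRing k n e) (f h : Form k n e)
    (h0 : ∃ t : k, evalAt F (f + t • h) ≠ 0) : {t : k | evalAt F (f + t • h) = 0}.Finite := by
  let Q : Polynomial k := aeval (fun m => Polynomial.C ((f : MvPolynomial (Fin n) k).coeff m.1) +
    Polynomial.X * Polynomial.C ((h : MvPolynomial (Fin n) k).coeff m.1)) F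
  have hQ : ∀ t, Q.eval t = evalAt F (f + t • h) := by
    intro t
    have : (Polynomial.aeval t).comp (aeval fun m =>
        Polynomial.C ((f : MvPolynomial (Fin n) k).coeff m.1) +
        Polynomial.X * Polynomial.C ((h : MvPolynomial (Fin n) k).coeff m.1)) =
        aeval fun m : {m : Fin n →₀ ℕ // m.degree = e} =>
          ((f + t • h : Form k n e) : MvPolynomial (Fin n) k).coeff m.1 := by
      ext m
      simp
      exact mul_comm _ _
    have h2 := AlgHom.congr_fun this F
    simpa [Q, evalAt, Polynomial.coe_aeval_eq_eval, aeval_eq_eval] using h2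
  obtain ⟨t, ht⟩ := h0
  have hQ0 : Q ≠ 0 := by
    rintro hQ0
    rw [← hQ, hQ0, Polynomial.eval_zero] at ht
    exact ht rfl
  refine (Polynomial.finite_setOfPred_isRoot hQ0).subset fun s hs => ?_
  simpa [Polynomial.IsRoot, hQ] using hs

end Zariski

/-! ### Curves in fibres and local dimension -/

section Dimension

/-- Two nonempty open traces on the parameter set are cofinite and hence meet, so the curve is
irreducible near `c s₀`. Its closure strictly contains the closed point `c s₀`, a chain of length
one. -/
theorem one_le_dimAt_of_curve {Y S : Type*} [TopologicalSpace Y] [T1Space Y] [Infinite S]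
    {c : S → Y} (hinj : Function.Injective c)
    (hc : ∀ O : Set Y, IsOpen O → (c ⁻¹' O).Nonempty → (c ⁻¹' O)ᶜ.Finite)
    {Z : Set Y} (hZ : Set.range c ⊆ Z) (s₀ : S) : 1 ≤ dimAt Z (c s₀) := by
  refine le_iInf fun U => le_iInf fun hU => le_iInf fun hs₀ => ?_
  rw [topologicalKrullDim, Order.one_le_krullDim_iff]
  let A : Set ↥(Z ∩ U) := {x | x.1 ∈ Set.range c}
  have hp : c s₀ ∈ Z ∩ U := ⟨hZ ⟨s₀, rfl⟩, hs₀⟩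
  have hA : IsIrreducible A := by
    refine ⟨⟨⟨c s₀, hp⟩, s₀, rfl⟩, ?_⟩
    rintro _ _ ⟨u, hu, rfl⟩ ⟨v, hv, rfl⟩ ⟨⟨_, hx⟩, ⟨s, rfl⟩, hxu⟩ ⟨⟨_, hy⟩, ⟨t, rfl⟩, hyv⟩
    have h1 := hc (u ∩ U) (hu.inter hU) ⟨s, hxu, hx.2⟩
    have h2 := hc (v ∩ U) (hv.inter hU) ⟨t, hyv, hy.2⟩
    obtain ⟨w, hw⟩ := (h1.union h2).infinite_compl.nonempty
    simp only [Set.compl_union, compl_compl] at hw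
    exact ⟨⟨c w, hZ ⟨w, rfl⟩, hw.1.2⟩, ⟨w, rfl⟩, hw.1.1, hw.2.1⟩
  -- A second point of the curve in `U`: only finitely many parameters are excluded.
  obtain ⟨s, hs⟩ := ((hc U hU ⟨s₀, hs₀⟩).union (Set.finite_singleton s₀)).infinite_compl.nonempty
  simp only [Set.compl_union, compl_compl] at hs
  refine ⟨{(⟨c s₀, hp⟩ : ↥(Z ∩ U))}, ⟨closure A, hA.closure, isClosed_closure⟩, ?_⟩
  rw [← SetLike.coe_ssubset_coe, Set.ssubset_iff_of_subset]
  · refine ⟨⟨c s, hZ ⟨s, rfl⟩, hs.1⟩, subset_closure ⟨s, rfl⟩, fun h => hs.2 ?_⟩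
    have h' : (⟨c s, hZ ⟨s, rfl⟩, hs.1⟩ : ↥(Z ∩ U)) = ⟨c s₀, hp⟩ := h
    exact hinj (congrArg Subtype.val h')
  · rintro x hx
    have hx' : x = ⟨c s₀, hp⟩ := hx
    subst hx'
    exact subset_closure ⟨s₀, rfl⟩

theorem dimAt_le_zero_of_subsingleton {Y : Type*} [TopologicalSpace Y] {Z : Set Y}
    (hZ : Z.Subsingleton) (y : Y) : dimAt Z y ≤ 0 := by
  have h1 : dimAt Z y ≤ topologicalKrullDim ↥(Z ∩ Set.univ) :=
    (iInf_le _ Set.univ).trans ((iInf_le _ isOpen_univ).trans (iInf_le _ (Set.mem_univ y)))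
  refine h1.trans ?_
  have : Subsingleton ↥(Z ∩ Set.univ) := by
    rw [Set.inter_univ]
    exact hZ.coe_sort
  exact topologicalKrullDim_zero_of_discreteTopology _

variable {k : Type*} [Field k] {n d : ℕ}

theorem NotInjectiveAt.of_positiveFibreDimAt {p : conciseLocus k n d}
    (hp : PositiveFibreDimAt p) : NotInjectiveAt p := by
  by_contra hne
  have h : ∀ q, nabla p = nabla q → q = p := by
    simpa [NotInjectiveAt, not_imp_not] using hne
  have hsub : (nabla ⁻¹' {nabla p}).Subsingleton := fun x hx y hy =>
    (h x (Eq.symm hx)).trans (h y (Eq.symm hy)).symm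
  have := le_trans hp (dimAt_le_zero_of_subsingleton hsub p)
  exact absurd this (by decide)

/-- A kernel vector of `1 + t T` is an eigenvector of `T` with eigenvalue `-t⁻¹`, and eigenvalues
are finite in number. -/
theorem finite_not_injective_id_add_smul {V : Type*} [AddCommGroup V] [Module k V]
    [Module.Finite k V] (T : Module.End k V) :
    {t : k | ¬ Function.Injective (LinearMap.id + t • T : Module.End k V)}.Finite := by
  refine (T.finite_hasEigenvalue.image fun a => -a⁻¹).subset fun t ht => ?_
  rw [Set.mem_ofPred_eq, injective_iff_map_eq_zero] at ht
  push Not at ht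
  obtain ⟨x, hx, hx0⟩ := ht
  have ht0 : t ≠ 0 := by
    rintro rfl
    simp at hx
    exact hx0 hx
  refine ⟨-t⁻¹, ?_, by simp⟩
  refine Module.End.hasEigenvalue_of_hasEigenvector (x := x) ⟨?_, hx0⟩
  rw [Module.End.mem_eigenspace_iff]
  have h2 : t • T x = -x := by
    rw [eq_neg_iff_add_eq_zero, add_comm]
    simpa using hx
  rw [neg_smul, ← smul_neg, ← h2, smul_smul, inv_mul_cancel₀ ht0, one_smul]

theorem eq_of_smul_add_smul_eq {V : Type*} [AddCommGroup V] [Module k V] {f h : V} (hf : f ≠ 0)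
    (hlin : ∀ c : k, h ≠ c • f) {a s t : k} (ha : a • (f + t • h) = f + s • h) : t = s := by
  have h2 : (a * t - s) • h = (1 - a) • f := by
    rw [smul_add, smul_smul] at ha
    rw [sub_smul, sub_smul, one_smul, sub_eq_sub_iff_add_eq_add, add_comm, ha]
  have h3 : a * t - s = 0 := by
    by_contra hne
    refine hlin ((a * t - s)⁻¹ * (1 - a)) ?_
    rw [mul_smul, ← h2, smul_smul, inv_mul_cancel₀ hne, one_smul]
  rw [h3, zero_smul] at h2
  have h4 : 1 - a = 0 := (smul_eq_zero.mp h2.symm).resolve_right hf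
  rw [← sub_eq_zero.mp h4, one_mul, sub_eq_zero] at h3
  exact h3

theorem HasGradientPartner.positiveFibreDimAt [Infinite k] (hn : 0 < n) {f : Form k n (d + 1)}
    (hinj : Function.Injective (gradMap f)) (hf : HasGradientPartner f) (hf0 : f ≠ 0)
    (hfc : Projectivization.mk k f hf0 ∈ conciseLocus k n d) :
    PositiveFibreDimAt ⟨Projectivization.mk k f hf0, hfc⟩ := by
  obtain ⟨h, T, hT, hTc⟩ := hf
  -- If `h = c f`, injectivity of the gradient gives `u ∘ T = c u` for all `u`, so `T` would be
  -- scalar.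
  have hlin : ∀ c : k, h ≠ c • f := by
    rintro c rfl
    refine hTc c ?_
    refine LinearMap.ext fun x => ?_
    rw [← sub_eq_zero, ← Module.forall_dual_apply_eq_zero_iff k]
    intro u
    have h1 : u ∘ₗ T = c • u := by
      apply hinj
      ext1
      rw [coe_gradMap, ← hT]
      simp
    simpa [sub_eq_zero] using LinearMap.congr_fun h1 x
  let B : Set k := {t | Function.Injective (LinearMap.id + t • T : Module.End k (Form k n 1))}
  have hB : Bᶜ.Finite := finite_not_injective_id_add_smul T
  have hBi : Infinite B := by
    have := hB.infinite_compl
    rw [compl_compl] at this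
    exact this.to_subtype
  have hg : ∀ t ∈ B, gradSpan (f + t • h) = gradSpan f := fun t ht =>
    gradSpan_eq_of_dirDeriv ht fun u => by
      simp [hT, LinearMap.comp_add, LinearMap.comp_smul]
  have hgi : ∀ t ∈ B, Function.Injective (gradMap (f + t • h)) := fun t ht => by
    rw [← finrank_gradSpan_eq_iff, hg t ht, finrank_gradSpan_eq_iff]
    exact hinj
  have hg0 : ∀ t ∈ B, f + t • h ≠ 0 := fun t ht h0 => by
    have h1 := (finrank_gradSpan_eq_iff _).mpr (hgi t ht)
    have h2 : gradSpan (0 : Form k n (d + 1)) = ⊥ := by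
      have : gradMap (0 : Form k n (d + 1)) = 0 := by
        simpa using gradMap_smul (0 : k) (0 : Form k n (d + 1))
      rw [gradSpan_eq_range, this, LinearMap.range_zero]
    rw [h0, h2, finrank_bot] at h1
    omega
  let c : B → conciseLocus k n d := fun t =>
    ⟨Projectivization.mk k (f + t.1 • h) (hg0 t.1 t.2),
      (mk_mem_conciseLocus_iff _ _).mpr (hgi t.1 t.2)⟩
  have hcinj : Function.Injective c := by
    intro s t hst
    have h1 := congrArg Subtype.val hst
    simp only [c] at h1
    rw [Projectivization.mk_eq_mk_iff'] at h1
    obtain ⟨a, ha⟩ := h1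
    exact Subtype.ext (eq_of_smul_add_smul_eq hf0 hlin ha).symm
  have h0B : (0 : k) ∈ B := by
    simp only [B, Set.mem_ofPred_eq, zero_smul, add_zero]
    exact Function.injective_id
  have hc0 : c ⟨0, h0B⟩ = ⟨Projectivization.mk k f hf0, hfc⟩ := by
    simp [c]
  unfold PositiveFibreDimAt
  rw [← hc0]
  refine one_le_dimAt_of_curve hcinj ?_ ?_ _
  -- Nonempty traces of open sets on the pencil are cofinite: shown for basic open sets, then
  -- propagated through the generation of the topology.
  · rintro _ ⟨O, hO, rfl⟩
    induction hO with
    | basic O hO =>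
      obtain ⟨r, F, hF, rfl⟩ := hO
      rintro ⟨t, ht⟩
      have ht' := (evalAt_rep_ne_zero_iff hF _ _).mp ht
      have hfin := finite_compl_evalAt_add_smul_ne_zero F f h ⟨t.1, ht'⟩
      refine (hfin.preimage Subtype.val_injective.injOn).subset fun s hs => ?_
      have := mt (evalAt_rep_ne_zero_iff hF _ _).mpr hs
      simpa using this
    | univ => simp
    | inter O₁ O₂ _ _ h1 h2 =>
      rintro ⟨t, ht⟩
      have := (h1 ⟨t, ht.1⟩).union (h2 ⟨t, ht.2⟩)
      rwa [← Set.compl_inter] at this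
    | sUnion 𝒪 _ ih =>
      rintro ⟨t, O, hO, ht⟩
      refine (ih O hO ⟨t, ht⟩).subset ?_
      exact Set.compl_subset_compl.mpr fun s hs => ⟨O, hO, hs⟩
  · rintro _ ⟨t, rfl⟩
    rw [Set.mem_preimage, Set.mem_singleton_iff]
    rw [nabla_mk_eq_iff, hg t.1 t.2, zero_smul, add_zero]

end Dimension

/-! ### Idempotents, square-zero maps and normal forms -/

section LinearAlgebra

variable {k V : Type*} [Field k] [AddCommGroup V] [Module k V] [Module.Finite k V]

/-- Write the minimal polynomial as `(X - a)^m q` with `q(a) ≠ 0`. If `q` is constant, `T - a` is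
nilpotent and its last nonzero power squares to zero. Otherwise a Bézout relation yields the
projection onto the generalized eigenspace of `a`. -/
theorem exists_aeval_idempotent_or_sq_zero [IsAlgClosed k] (T : Module.End k V)
    (hT : ∀ c : k, T ≠ c • LinearMap.id) :
    ∃ q : Polynomial k,
      (IsIdempotentElem (Polynomial.aeval T q) ∧ Polynomial.aeval T q ≠ 0 ∧
        Polynomial.aeval T q ≠ 1) ∨
      (Polynomial.aeval T q * Polynomial.aeval T q = 0 ∧ Polynomial.aeval T q ≠ 0) := by
  have : Nontrivial V := by
    by_contra h
    rw [not_nontrivial_iff_subsingleton] at h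
    exact hT 0 (LinearMap.ext fun x => Subsingleton.elim _ _)
  obtain ⟨a, ha⟩ := Module.End.exists_eigenvalue T
  have haev : ∀ p : Polynomial k, minpoly k T ∣ p → p.eval a = 0 := by
    rintro _ ⟨r, rfl⟩
    have : (minpoly k T).IsRoot a := Module.End.isRoot_of_hasEigenvalue ha
    rw [Polynomial.eval_mul, this, zero_mul]
  have hμ0 : minpoly k T ≠ 0 := minpoly.ne_zero (Algebra.IsIntegral.isIntegral T)
  obtain ⟨q, hq, hqa⟩ := Polynomial.exists_eq_pow_rootMultiplicity_mul_and_not_dvd _ hμ0 a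
  set m := Polynomial.rootMultiplicity a (minpoly k T)
  by_cases hqu : IsUnit q
  · have hN : (T - a • LinearMap.id) ^ m = 0 := by
      have h1 : Polynomial.aeval T ((Polynomial.X - Polynomial.C a) ^ m) = 0 := by
        rw [← minpoly.dvd_iff]
        obtain ⟨r, hr⟩ := hqu.exists_right_inv
        refine ⟨r, ?_⟩
        rw [hq, mul_assoc, hr, mul_one]
      rw [map_pow, map_sub, Polynomial.aeval_X, Polynomial.aeval_C,
        Algebra.algebraMap_eq_smul_one] at h1
      exact h1
    have hnil : IsNilpotent (T - a • LinearMap.id : Module.End k V) := ⟨m, hN⟩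
    have hN0 : (T - a • LinearMap.id : Module.End k V) ≠ 0 := sub_ne_zero.mpr (hT a)
    set N : Module.End k V := T - a • LinearMap.id
    have hc : 2 ≤ nilpotencyClass N := by
      by_contra! hlt
      have h1 := pow_nilpotencyClass hnil
      interval_cases nilpotencyClass N
      · simp at h1
      · simp [hN0] at h1
    have hNev : ∀ j, Polynomial.aeval T ((Polynomial.X - Polynomial.C a) ^ j) = N ^ j := by
      intro j
      rw [map_pow, map_sub, Polynomial.aeval_X, Polynomial.aeval_C,
        Algebra.algebraMap_eq_smul_one]
      rfl
    refine ⟨(Polynomial.X - Polynomial.C a) ^ (nilpotencyClass N - 1), Or.inr ?_⟩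
    rw [hNev, ← pow_add]
    refine ⟨pow_eq_zero_of_le (by omega) (pow_nilpotencyClass hnil), ?_⟩
    exact pow_pred_nilpotencyClass hnil
  · have hcop : IsCoprime ((Polynomial.X - Polynomial.C a) ^ m) q :=
      ((Polynomial.irreducible_X_sub_C a).coprime_iff_not_dvd.mpr hqa).pow_left
    obtain ⟨r, s, hrs⟩ := hcop
    have hm0 : m ≠ 0 := by
      have := (Polynomial.rootMultiplicity_pos hμ0).mpr (Module.End.isRoot_of_hasEigenvalue ha)
      exact this.ne'
    refine ⟨s * q, Or.inl ⟨?_, ?_, ?_⟩⟩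
    · rw [IsIdempotentElem, ← map_mul, ← sub_eq_zero, ← map_sub, ← minpoly.dvd_iff]
      -- By Bézout, `sq (sq - 1) = -sq · r (X - a)^m`, a multiple of the minimal polynomial.
      refine ⟨-(r * s), ?_⟩
      rw [hq]
      linear_combination (s * q) * hrs
    · intro h0
      rw [← minpoly.dvd_iff] at h0
      have h1 := haev _ h0
      have h2 := congrArg (Polynomial.eval a) hrs
      rw [Polynomial.eval_add, h1] at h2
      simp [hm0] at h2
    · intro h1
      rw [← map_one (Polynomial.aeval (R := k) T), ← sub_eq_zero, ← map_sub, ← minpoly.dvd_iff] at h1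
      have h2 : q ∣ s * q - 1 := (Dvd.intro_left _ hq.symm).trans h1
      exact hqu (isUnit_of_dvd_one ((dvd_sub_right (Dvd.intro_left s rfl)).mp h2))

/-- A complement `C` of `ker B` embeds into `ker B` through `B`. A basis `x` of `C`, its image `y =
B x`, and a completion `z` of `y` to a basis of `ker B` give the required basis. -/
theorem exists_basis_of_sq_zero (B : Module.End k V) (hB : B * B = 0) (hB0 : B ≠ 0) :
    ∃ (l m : ℕ) (b : Module.Basis (Fin l ⊕ (Fin l ⊕ Fin m)) k V), 1 ≤ l ∧
      (∀ i, B (b (Sum.inl i)) = b (Sum.inr (Sum.inl i))) ∧ ∀ j, B (b (Sum.inr j)) = 0 := by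
  obtain ⟨C, hC⟩ := Submodule.exists_isCompl (LinearMap.ker B)
  let bC := Module.finBasis k C
  have hBB : ∀ x, B (B x) = 0 := fun x => LinearMap.congr_fun hB x
  let θ : C →ₗ[k] LinearMap.ker B :=
    LinearMap.codRestrict _ (B ∘ₗ C.subtype) fun x => by simp [hBB]
  have hθ : LinearMap.ker θ = ⊥ := by
    rw [LinearMap.ker_eq_bot']
    intro x hx
    have h1 : B x = 0 := congrArg Subtype.val hx
    have h2 : (x : V) ∈ LinearMap.ker B ⊓ C := ⟨h1, x.2⟩
    rw [hC.inf_eq_bot] at h2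
    exact Subtype.ext h2
  have hli : LinearIndependent k (θ ∘ bC) := bC.linearIndependent.map' θ hθ
  obtain ⟨Z, hZ⟩ := Submodule.exists_isCompl (Submodule.span k (Set.range (θ ∘ bC)))
  let bK := ((Module.Basis.span hli).prod (Module.finBasis k Z)).map
    (Submodule.prodEquivOfIsCompl _ _ hZ)
  let b := (bC.prod bK).map (Submodule.prodEquivOfIsCompl _ _ hC.symm)
  have hbl : ∀ i, b (Sum.inl i) = bC i := fun i => by simp [b]
  have hbr : ∀ j, b (Sum.inr j) = bK j := fun i => by simp [b]
  refine ⟨_, _, b, ?_, fun i => ?_, fun j => ?_⟩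
  · rw [Nat.one_le_iff_ne_zero]
    intro h0
    have hCb : C = ⊥ := Submodule.finrank_eq_zero.mp h0
    rw [hCb] at hC
    exact hB0 (LinearMap.ker_eq_top.mp (eq_top_of_isCompl_bot hC))
  · rw [hbl, hbr]
    simp [bK, Module.Basis.span_apply]
    rfl
  · rw [hbr]
    exact (bK j).2

end LinearAlgebra

/-! ### Forms in fewer variables and integration of gradients -/

section Rename

variable {k σ τ : Type*} [Field k]

theorem exists_rename_eq_of_pderiv_eq_zero {e : ℕ}
    (he : ∀ m : ℕ, 0 < m → m ≤ e → (m : k) ≠ 0) {p : MvPolynomial σ k} (hp : p.IsHomogeneous e)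
    {a : τ → σ} (ha : Function.Injective a) (h : ∀ i ∉ Set.range a, pderiv i p = 0) :
    ∃ r : MvPolynomial τ k, r.IsHomogeneous e ∧ rename a r = p := by
  obtain ⟨r, hr⟩ := exists_rename_eq_of_vars_subset_range p a ha (by
    intro i hi
    by_contra hia
    obtain ⟨m, hm, him⟩ := (mem_vars_iff_mem_support i).mp hi
    exact Finsupp.mem_support_iff.mp him
      (apply_eq_zero_of_pderiv_eq_zero he hp (h i hia) hm))
  exact ⟨r, (IsHomogeneous.rename_isHomogeneous_iff ha).mp (hr ▸ hp), hr⟩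

/-- A system of forms of degree `d` with symmetric Jacobian is a gradient if `d + 1 ≠ 0` in `k`. -/
theorem exists_pderiv_eq [Fintype σ] {d : ℕ} (hd : ((d + 1 : ℕ) : k) ≠ 0)
    (r : σ → MvPolynomial σ k) (hr : ∀ i, (r i).IsHomogeneous d)
    (hsymm : ∀ i j, pderiv i (r j) = pderiv j (r i)) :
    ∃ H : MvPolynomial σ k, H.IsHomogeneous (d + 1) ∧ ∀ i, pderiv i H = r i := by
  classical
  -- Euler's formula dictates this potential. By symmetry, `∑ X_i ∂_j r_i = ∑ X_i ∂_i r_j = d r_j`,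
  -- and the product rule adds one more `r_j`.
  refine ⟨C ((d + 1 : ℕ) : k)⁻¹ * ∑ i, X i * r i, ?_, fun j => ?_⟩
  · refine IsHomogeneous.C_mul (IsHomogeneous.sum _ _ _ fun i _ => ?_) _
    rw [add_comm]
    exact (isHomogeneous_X k i).mul (hr i)
  · have h1 : ∑ i, X i * pderiv i (r j) = d • r j := (hr j).sum_X_mul_pderiv
    have h2 : pderiv j (∑ i, X i * r i) = ((d + 1 : ℕ) : k) • r j := by
      simp only [map_sum, pderiv_mul, Finset.sum_add_distrib, hsymm j, h1, pderiv_X]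
      simp [Pi.single_apply, add_smul, add_comm, Nat.cast_smul_eq_nsmul]
    rw [pderiv_C_mul, h2, ← smul_eq_C_mul, smul_smul, inv_mul_cancel₀ hd, one_smul]

end Rename

/-! ### Hessian self-adjoint endomorphisms -/

section SelfAdjoint

variable {k : Type*} [Field k] {n : ℕ}

/-- An endomorphism of the space of linear forms is self-adjoint for the Hessian of `f`. -/
def IsHessianSelfAdjoint (f : MvPolynomial (Fin n) k) (T : Module.End k (Form k n 1)) : Prop :=
  ∀ u v : Module.Dual k (Form k n 1),
    dirDeriv (u ∘ₗ T) (dirDeriv v f) = dirDeriv u (dirDeriv (v ∘ₗ T) f)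

/-- Both sides equal the second derivative `∂_u ∂_v h`. -/
theorem IsHessianSelfAdjoint.of_partner {f h : MvPolynomial (Fin n) k}
    {T : Module.End k (Form k n 1)} (hT : ∀ u : Module.Dual k (Form k n 1),
      dirDeriv u h = dirDeriv (u ∘ₗ T) f) : IsHessianSelfAdjoint f T := fun u v => by
  rw [dirDeriv_comm, ← hT, ← hT, dirDeriv_comm]

theorem IsHessianSelfAdjoint.pow {f : MvPolynomial (Fin n) k} {T : Module.End k (Form k n 1)}
    (hT : IsHessianSelfAdjoint f T) (j : ℕ) : IsHessianSelfAdjoint f (T ^ j) := by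
  induction j with
  | zero => exact fun u v => rfl
  | succ j ih =>
    intro u v
    have h1 : u ∘ₗ (T ^ (j + 1)) = (u ∘ₗ T ^ j) ∘ₗ T := by rw [pow_succ]; rfl
    have h2 : v ∘ₗ (T ^ (j + 1)) = (v ∘ₗ T) ∘ₗ T ^ j := by rw [pow_succ']; rfl
    rw [h1, h2, hT, ih]

theorem IsHessianSelfAdjoint.aeval {f : MvPolynomial (Fin n) k} {T : Module.End k (Form k n 1)}
    (hT : IsHessianSelfAdjoint f T) (q : Polynomial k) :
    IsHessianSelfAdjoint f (Polynomial.aeval T q) := by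
  induction q using Polynomial.induction_on' with
  | add p q hp hq =>
    intro u v
    rw [map_add, LinearMap.comp_add, LinearMap.comp_add, map_add, map_add, Derivation.add_apply,
      Derivation.add_apply, map_add, hp, hq]
  | monomial j a =>
    intro u v
    rw [Polynomial.aeval_monomial, Algebra.algebraMap_eq_smul_one, smul_mul_assoc, one_mul,
      LinearMap.comp_smul, LinearMap.comp_smul, map_smul, map_smul, Derivation.smul_apply,
      Derivation.smul_apply, Derivation.map_smul, hT.pow j]

variable {e : ℕ} {f : Form k n e}

theorem IsHessianSelfAdjoint.isDirectSum (he : ∀ m : ℕ, 0 < m → m ≤ e → (m : k) ≠ 0)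
    (hf : IsConcise f) {B : Module.End k (Form k n 1)}
    (hB : IsHessianSelfAdjoint (f : MvPolynomial (Fin n) k) B) (hid : IsIdempotentElem B)
    (h0 : B ≠ 0) (h1 : B ≠ 1) : IsDirectSum f := by
  classical
  have hBB : ∀ x, B (B x) = B x := fun x => LinearMap.congr_fun hid x
  have hUW : IsCompl (LinearMap.range B) (LinearMap.ker B) :=
    LinearMap.IsIdempotentElem.isCompl hid
  let b := isComplBasis hUW
  obtain ⟨p, hp, hpf⟩ := exists_aeval_basis b f.2
  have hinl : ∀ i, b.coord (Sum.inl i) ∘ₗ B = b.coord (Sum.inl i) := fun i => by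
    ext x
    have : B x - x ∈ LinearMap.ker B := by simp [hBB]
    have := isComplBasis_coord_inl hUW i this
    rw [map_sub, sub_eq_zero] at this
    exact this
  have hinr : ∀ j, b.coord (Sum.inr j) ∘ₗ B = 0 := fun j => by
    ext x
    exact isComplBasis_coord_inr hUW j ⟨x, rfl⟩
  -- The first coordinate is fixed by composition with `B` and the second is killed, so moving `B`
  -- across gives zero.
  have hmix : ∀ i j, pderiv (Sum.inl i) (pderiv (Sum.inr j) p) = 0 := fun i j => by
    apply aeval_basis_injective b
    rw [← dirDeriv_coord_aeval, ← dirDeriv_coord_aeval, hpf, ← hinl, hB, hinr, map_zero]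
    simp
  -- `P` selects monomials in the `range B` variables alone. Any other monomial contains a `ker B`
  -- variable, hence by `hmix` no `range B` variable.
  let P : (Fin (Module.finrank k (LinearMap.range B)) ⊕ Fin (Module.finrank k (LinearMap.ker B)) →₀ ℕ) →
      Prop := fun m => ∀ j, m (Sum.inr j) = 0
  have hmem : ∀ m ∈ p.support, ∀ W : Submodule k (Form k n 1), (∀ i, m i ≠ 0 → b i ∈ W) →
      MvPolynomial.aeval (fun i => (b i : MvPolynomial (Fin n) k)) (monomial m (p.coeff m)) ∈
        symPow W e := by
    intro m hm W h
    refine aeval_mem_symPow (isHomogeneous_monomial _ ?_) fun m' hm' i hi => ?_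
    · by_contra hne
      exact mem_support_iff.mp hm (hp.coeff_eq_zero hne)
    · have := Finset.mem_singleton.mp (support_monomial_subset hm')
      subst this
      exact h i hi
  let p₁ := ∑ m ∈ p.support with P m, monomial m (p.coeff m)
  let p₂ := ∑ m ∈ p.support with ¬ P m, monomial m (p.coeff m)
  have hsum : p₁ + p₂ = p := by
    rw [Finset.sum_filter_add_sum_filter_not, support_sum_monomial_coeff]
  have hf₁ : MvPolynomial.aeval (fun i => (b i : MvPolynomial (Fin n) k)) p₁ ∈
      symPow (LinearMap.range B) e := by
    rw [map_sum]
    refine Submodule.sum_mem _ fun m hm => ?_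
    rw [Finset.mem_filter] at hm
    refine hmem m hm.1 _ fun i hi => ?_
    rcases i with i | j
    · exact isComplBasis_inl_mem hUW i
    · exact absurd (hm.2 j) hi
  have hf₂ : MvPolynomial.aeval (fun i => (b i : MvPolynomial (Fin n) k)) p₂ ∈
      symPow (LinearMap.ker B) e := by
    rw [map_sum]
    refine Submodule.sum_mem _ fun m hm => ?_
    rw [Finset.mem_filter] at hm
    refine hmem m hm.1 _ fun i hi => ?_
    rcases i with i | j
    · obtain ⟨j, hj⟩ := not_forall.mp hm.2
      rcases apply_eq_zero_or_of_pderiv_pderiv_eq_zero he hp Sum.inl_ne_inr (hmix i j) hm.1 with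
        h | h
      · exact absurd h hi
      · exact absurd h hj
    · exact isComplBasis_inr_mem hUW j
  have hfs : (f : MvPolynomial (Fin n) k) =
      MvPolynomial.aeval (fun i => (b i : MvPolynomial (Fin n) k)) p₁ +
      MvPolynomial.aeval (fun i => (b i : MvPolynomial (Fin n) k)) p₂ := by
    rw [← map_add, hsum, hpf]
  -- If one summand vanished, conciseness would make `ker B` or `range B` everything, so `B = 0` or
  -- `B = 1`.
  refine ⟨_, _, hUW, _, hf₁, _, hf₂, fun hz => ?_, fun hz => ?_, hfs⟩
  · rw [hz, zero_add] at hfs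
    exact h0 (LinearMap.ker_eq_top.mp (hf _ (hfs ▸ hf₂)))
  · rw [hz, add_zero] at hfs
    have hsur := LinearMap.range_eq_top.mp (hf _ (hfs ▸ hf₁))
    refine h1 (LinearMap.ext fun x => ?_)
    obtain ⟨y, rfl⟩ := hsur x
    exact hBB y

/-- Dually, `B` sends the `y_i` coordinate to the `x_i` coordinate and kills the others.
Self-adjointness then says that each `∂p/∂x_i` involves only `y`, and that these derivatives have
symmetric Jacobian, so they form the gradient of some `H`. The remainder `p - ∑ x_i ∂p/∂x_i` is free
of `x`. -/
theorem IsHessianSelfAdjoint.isLDS {d : ℕ} {f : Form k n (d + 1)}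
    (he : ∀ m : ℕ, 0 < m → m ≤ d + 1 → (m : k) ≠ 0) {B : Module.End k (Form k n 1)}
    (hB : IsHessianSelfAdjoint (f : MvPolynomial (Fin n) k) B) (hsq : B * B = 0) (h0 : B ≠ 0) :
    IsLDS f := by
  classical
  obtain ⟨l, m, b, hl, hbx, hby⟩ := exists_basis_of_sq_zero B hsq h0
  obtain ⟨p, hp, hpf⟩ := exists_aeval_basis b f.2
  have hx : ∀ i, b.coord (Sum.inl i) ∘ₗ B = 0 := fun i => by
    refine b.ext fun j => ?_
    rcases j with j | j <;> simp [hbx, hby]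
  have hy : ∀ i, b.coord (Sum.inr (Sum.inl i)) ∘ₗ B = b.coord (Sum.inl i) := fun i => by
    refine b.ext fun j => ?_
    rcases j with j | j <;> simp [hbx, hby, Finsupp.single_apply]
  have hz : ∀ i, b.coord (Sum.inr (Sum.inr i)) ∘ₗ B = 0 := fun i => by
    refine b.ext fun j => ?_
    rcases j with j | j <;> simp [hbx, hby]
  have hxx : ∀ i j, pderiv (Sum.inl i) (pderiv (Sum.inl j) p) = 0 := fun i j => by
    apply aeval_basis_injective b
    rw [← dirDeriv_coord_aeval, ← dirDeriv_coord_aeval, hpf, ← hy i, hB, hx, map_zero]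
    simp
  have hzx : ∀ i j, pderiv (Sum.inr (Sum.inr i)) (pderiv (Sum.inl j) p) = 0 := fun i j => by
    apply aeval_basis_injective b
    rw [← dirDeriv_coord_aeval, ← dirDeriv_coord_aeval, hpf, ← hy j, ← hB, hz, map_zero]
    simp
  have hxy : ∀ i j, pderiv (Sum.inr (Sum.inl i)) (pderiv (Sum.inl j) p) =
      pderiv (Sum.inr (Sum.inl j)) (pderiv (Sum.inl i) p) := fun i j => by
    apply aeval_basis_injective b
    rw [← dirDeriv_coord_aeval, ← dirDeriv_coord_aeval, ← dirDeriv_coord_aeval,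
      ← dirDeriv_coord_aeval, hpf, ← hy j, ← hB, hy, dirDeriv_comm]
  have hinj : Function.Injective (fun i : Fin l => (Sum.inr (Sum.inl i) : Fin l ⊕ (Fin l ⊕ Fin m))) :=
    Sum.inr_injective.comp Sum.inl_injective
  have hq : ∀ i, ∃ r : MvPolynomial (Fin l) k, r.IsHomogeneous d ∧
      rename (fun i : Fin l => (Sum.inr (Sum.inl i) : Fin l ⊕ (Fin l ⊕ Fin m))) r =
        pderiv (Sum.inl i) p := fun i => by
    refine exists_rename_eq_of_pderiv_eq_zero (fun m h1 h2 => he m h1 (h2.trans (Nat.le_succ d)))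
      (by simpa using hp.pderiv (i := Sum.inl i)) hinj fun j hj => ?_
    rcases j with j | j | j
    · exact hxx j i
    · exact absurd ⟨j, rfl⟩ hj
    · exact hzx j i
  choose r hr hrq using hq
  obtain ⟨H, hH, hHr⟩ := exists_pderiv_eq (he _ (Nat.succ_pos d) le_rfl) r hr (fun i j => by
    apply rename_injective _ hinj
    rw [← pderiv_rename hinj, ← pderiv_rename hinj, hrq, hrq, hxy])
  have hg : (p - ∑ i, X (Sum.inl i) * pderiv (Sum.inl i) p).IsHomogeneous (d + 1) := by
    refine hp.sub (IsHomogeneous.sum _ _ _ fun i _ => ?_)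
    rw [add_comm]
    exact (isHomogeneous_X k _).mul (by simpa using hp.pderiv (i := Sum.inl i))
  obtain ⟨G, hG, hGg⟩ := exists_rename_eq_of_pderiv_eq_zero he hg
    (a := (Sum.inr : Fin l ⊕ Fin m → Fin l ⊕ (Fin l ⊕ Fin m))) Sum.inr_injective (fun j hj => by
      rcases j with j | j
      · simp [hxx, Pi.single_apply]
      · exact absurd ⟨j, rfl⟩ hj)
  refine ⟨l, m, b, H, G, hl, hH, hG, ?_⟩
  have hps : p = ∑ i, X (Sum.inl i) *
      rename (fun i : Fin l => (Sum.inr (Sum.inl i) : Fin l ⊕ (Fin l ⊕ Fin m))) (pderiv i H) +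
      rename Sum.inr G := by
    simp only [hHr, hrq, hGg]
    ring
  rw [← hpf]
  conv_lhs => rw [hps]
  simp only [map_add, map_sum, map_mul, aeval_X, aeval_rename]
  rfl

theorem HasGradientPartner.isDirectSum_or_isLDS [IsAlgClosed k] {d : ℕ} {f : Form k n (d + 1)}
    (he : ∀ m : ℕ, 0 < m → m ≤ d + 1 → (m : k) ≠ 0) (hf : IsConcise f)
    (hp : HasGradientPartner f) : IsDirectSum f ∨ IsLDS f := by
  obtain ⟨h, T, hT, hTc⟩ := hp
  have hsa := IsHessianSelfAdjoint.of_partner hT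
  obtain ⟨q, ⟨hid, h0, h1⟩ | ⟨hsq, h0⟩⟩ := exists_aeval_idempotent_or_sq_zero T hTc
  · exact Or.inl ((hsa.aeval q).isDirectSum he hf hid h0 h1)
  · exact Or.inr ((hsa.aeval q).isLDS he hsq h0)

theorem hasGradientPartner_of_gradSpan_eq {d : ℕ} (hd : ((d + 1 : ℕ) : k) ≠ 0)
    {f g : Form k n (d + 1)} (hs : gradSpan f = gradSpan g) (hfg : ∀ c : k, g ≠ c • f) :
    HasGradientPartner f := by
  have h1 : ∀ i, ∃ v, gradMap f v = gradMap g ((varBasis k n).coord i) := fun i => by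
    rw [← LinearMap.mem_range, ← gradSpan_eq_range, hs, gradSpan_eq_range]
    exact ⟨_, rfl⟩
  choose v hv using h1
  -- Chosen so that the transpose of `T` sends the `i`-th coordinate functional to `v i`.
  let T : Module.End k (Form k n 1) := ∑ i, (v i).smulRight (varBasis k n i)
  have hTv : ∀ i, (varBasis k n).coord i ∘ₗ T = v i := fun i => by
    classical
    ext x
    simp [T, -varBasis_apply, Finsupp.single_apply]
  have hT : ∀ u, gradMap g u = gradMap f (u ∘ₗ T) := fun u => by
    have : gradMap g = gradMap f ∘ₗ T.dualMap := by
      refine (varBasis k n).dualBasis.ext fun i => ?_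
      rw [Module.Basis.coe_dualBasis, ← hv, ← hTv]
      rfl
    rw [this]
    rfl
  refine ⟨g, T, fun u => congrArg Subtype.val (hT u), ?_⟩
  intro c hc
  refine hfg c ?_
  rw [← sub_eq_zero]
  ext1
  -- If `T = c`, all derivatives of `g - c f` vanish, and Euler's formula with `d + 1 ≠ 0` gives `g
  -- = c f`.
  refine eq_zero_of_dirDeriv_eq_zero hd (g - c • f).2 fun u => ?_
  have h2 := congrArg Subtype.val (hT u)
  rw [coe_gradMap, coe_gradMap, hc, LinearMap.comp_smul] at h2
  simp [h2]

end SelfAdjoint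

/-! ### The equivalences for concise forms -/

section Equivalence

variable {k : Type*} [Field k] {n d : ℕ}

theorem NotInjectiveAt.hasGradientPartner (hd : ((d + 1 : ℕ) : k) ≠ 0) {f : Form k n (d + 1)}
    {hf0 : f ≠ 0} {hfc : Projectivization.mk k f hf0 ∈ conciseLocus k n d}
    (h : NotInjectiveAt ⟨Projectivization.mk k f hf0, hfc⟩) : HasGradientPartner f := by
  obtain ⟨⟨q, hq⟩, hne, hnab⟩ := h
  induction q using Projectivization.ind with
  | h g hg =>
    rw [nabla_mk_eq_iff] at hnab
    refine hasGradientPartner_of_gradSpan_eq hd hnab fun c hc => hne ?_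
    ext1
    exact (Projectivization.mk_eq_mk_iff' k _ _ _ _).mpr ⟨c, hc.symm⟩

theorem IsConcise.gradMap_injective (he : ∀ m : ℕ, 0 < m → m ≤ d + 1 → (m : k) ≠ 0)
    {f : Form k n (d + 1)} (hf : IsConcise f) : Function.Injective (gradMap f) := by
  rw [injective_iff_map_eq_zero]
  exact fun u hu => hf.dirDeriv_ne_zero he (congrArg Subtype.val hu)

theorem IsConcise.ne_zero (hn : 0 < n) {f : Form k n (d + 1)} (hf : IsConcise f) : f ≠ 0 := by
  rintro rfl
  have h := hf ⊥ (by simp)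
  have h2 := finrank_linearForm (k := k) (n := n)
  rw [← finrank_top, ← h, finrank_bot] at h2
  omega

theorem IsConcise.tfae [IsAlgClosed k] (hn : 0 < n)
    (he : ∀ m : ℕ, 0 < m → m ≤ d + 1 → (m : k) ≠ 0)
    {f : Form k n (d + 1)} (hf : IsConcise f) (hf0 : f ≠ 0)
    (hfc : Projectivization.mk k f hf0 ∈ conciseLocus k n d) :
    List.TFAE [IsDirectSum f ∨ IsLDS f, NotInjectiveAt ⟨Projectivization.mk k f hf0, hfc⟩,
      PositiveFibreDimAt ⟨Projectivization.mk k f hf0, hfc⟩] := by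
  tfae_have 1 → 3 := fun h =>
    HasGradientPartner.positiveFibreDimAt hn (hf.gradMap_injective he)
      (h.elim IsDirectSum.hasGradientPartner IsLDS.hasGradientPartner) hf0 hfc
  tfae_have 3 → 2 := NotInjectiveAt.of_positiveFibreDimAt
  tfae_have 2 → 1 := fun h =>
    (h.hasGradientPartner (he _ (Nat.succ_pos d) le_rfl)).isDirectSum_or_isLDS he hf
  tfae_finish

end Equivalence

/-! ### Semistability and one-parameter subgroups -/

section Semistable

variable {k : Type*} [Field k] {n e : ℕ}

theorem subst_toMatrix (L : Module.End k (Form k n 1)) (a : Form k n 1) :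
    subst (LinearMap.toMatrix (varBasis k n) (varBasis k n) L) (a : MvPolynomial (Fin n) k) =
      (L a : MvPolynomial (Fin n) k) := by
  have h : (subst (LinearMap.toMatrix (varBasis k n) (varBasis k n) L)).toLinearMap ∘ₗ
      (homogeneousSubmodule (Fin n) k 1).subtype =
      (homogeneousSubmodule (Fin n) k 1).subtype ∘ₗ L := by
    refine (varBasis k n).ext fun i => ?_
    have h1 := congrArg Subtype.val ((varBasis k n).sum_repr (L (varBasis k n i)))
    rw [AddSubmonoidClass.coe_finsetSum] at h1
    have h2 : ((varBasis k n i : Form k n 1) : MvPolynomial (Fin n) k) = X i := by simp [varForm]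
    simp only [LinearMap.comp_apply, Submodule.subtype_apply, AlgHom.toLinearMap_apply, h2]
    rw [← h1, subst, aeval_X]
    refine Finset.sum_congr rfl fun j _ => ?_
    simp [LinearMap.toMatrix_apply, varForm]
  exact LinearMap.congr_fun h a

theorem prod_zpow_eq_zpow_sum {ι : Type*} (s : Finset ι) {t : k} (ht : t ≠ 0) (w : ι → ℤ) :
    ∏ i ∈ s, t ^ w i = t ^ ∑ i ∈ s, w i := by
  classical
  induction s using Finset.induction_on with
  | empty => simp
  | insert a s ha ih => rw [Finset.prod_insert ha, Finset.sum_insert ha, ih, zpow_add₀ ht]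

/-- The easy half of the Hilbert–Mumford criterion. If all weights were positive, `f` would
degenerate to `0` under a subgroup of `SL(n)`; `F` is constant along the orbit but vanishes at `0`,
being homogeneous of positive degree. -/
theorem IsSemistable.exists_weight_nonpos [Infinite k] {f : Form k n e} (hf : IsSemistable f)
    {ι : Type*} [Fintype ι] (b : Module.Basis ι k (Form k n 1)) (w : ι → ℤ) (hw : ∑ i, w i = 0)
    {p : MvPolynomial ι k} (hp : p.IsHomogeneous e)
    (hpf : aeval (fun i => (b i : MvPolynomial (Fin n) k)) p = f) :
    ∃ m ∈ p.support, ∑ i, (m i : ℤ) * w i ≤ 0 := by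
  classical
  by_contra! hpos
  obtain ⟨r, F, hr, hF, hinv, hne⟩ := hf
  let g : k → Form k n e := fun t => ⟨_, isHomogeneous_aeval_linearForm (fun i => t ^ w i • b i) hp⟩
  have hg : ∀ t ≠ 0, evalAt F (g t) = evalAt F f := fun t ht => by
    let L : Module.End k (Form k n 1) := b.constr k fun i => t ^ w i • b i
    have hdet : (LinearMap.toMatrix (varBasis k n) (varBasis k n) L).det = 1 := by
      have h1 : LinearMap.toMatrix b b L = Matrix.diagonal fun i => t ^ w i := by
        ext i j
        simp [LinearMap.toMatrix_apply, L, Matrix.diagonal_apply, Finsupp.single_apply, eq_comm]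
        split_ifs with h
        · rw [h]
        · rfl
      rw [LinearMap.det_toMatrix, ← LinearMap.det_toMatrix b, h1, Matrix.det_diagonal,
        prod_zpow_eq_zpow_sum _ ht, hw, zpow_zero]
    refine hinv ⟨_, hdet⟩ f (g t) ?_
    change aeval _ p = subst _ (f : MvPolynomial (Fin n) k)
    rw [← hpf, ← AlgHom.comp_apply]
    congr 1
    ext1 i
    simp only [aeval_X, AlgHom.comp_apply, subst_toMatrix, L, Module.Basis.constr_basis]
  -- `F` along the subgroup, as a polynomial in `t`. Positive weights make `toNat` harmless and
  -- allow evaluation at `t = 0`.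
  let Q : Polynomial k := aeval (fun μ : {m : Fin n →₀ ℕ // m.degree = e} =>
    ∑ m ∈ p.support, Polynomial.C (p.coeff m *
      coeff μ.1 (∏ i, (b i : MvPolynomial (Fin n) k) ^ m i)) *
        Polynomial.X ^ (∑ i, (m i : ℤ) * w i).toNat) F
  have hQ : ∀ t, Q.eval t = eval (fun μ : {m : Fin n →₀ ℕ // m.degree = e} =>
      ∑ m ∈ p.support, p.coeff m * coeff μ.1 (∏ i, (b i : MvPolynomial (Fin n) k) ^ m i) *
        t ^ (∑ i, (m i : ℤ) * w i).toNat) F := fun t => by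
    have : (Polynomial.aeval t).comp (aeval fun μ : {m : Fin n →₀ ℕ // m.degree = e} =>
        ∑ m ∈ p.support, Polynomial.C (p.coeff m *
          coeff μ.1 (∏ i, (b i : MvPolynomial (Fin n) k) ^ m i)) *
            Polynomial.X ^ (∑ i, (m i : ℤ) * w i).toNat) =
        aeval fun μ : {m : Fin n →₀ ℕ // m.degree = e} =>
          ∑ m ∈ p.support, p.coeff m * coeff μ.1 (∏ i, (b i : MvPolynomial (Fin n) k) ^ m i) *
            t ^ (∑ i, (m i : ℤ) * w i).toNat := by
      ext μ
      simp only [AlgHom.comp_apply, aeval_X, map_sum, map_mul, map_pow, Polynomial.aeval_X,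
        Polynomial.aeval_C, Algebra.algebraMap_self, RingHom.id_apply]
    have h2 := AlgHom.congr_fun this F
    simpa only [Q, Polynomial.coe_aeval_eq_eval, aeval_eq_eval, AlgHom.comp_apply] using h2
  have hQt : ∀ t ≠ 0, Q.eval t = evalAt F f := fun t ht => by
    rw [← hg t ht, hQ, evalAt]
    congr 2
    funext μ
    change _ = coeff μ.1 (aeval _ p)
    rw [aeval_def, eval₂_eq', coeff_sum]
    refine Finset.sum_congr rfl fun m hm => ?_
    have h1 : ∏ i, ((t ^ w i • b i : Form k n 1) : MvPolynomial (Fin n) k) ^ m i =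
        C (t ^ (∑ i, (m i : ℤ) * w i).toNat) * ∏ i, (b i : MvPolynomial (Fin n) k) ^ m i := by
      rw [← zpow_natCast, Int.toNat_of_nonneg (hpos m hm).le, ← prod_zpow_eq_zpow_sum _ ht,
        map_prod, ← Finset.prod_mul_distrib]
      refine Finset.prod_congr rfl fun i _ => ?_
      rw [Submodule.coe_smul, smul_eq_C_mul, mul_pow, ← map_pow, mul_comm (m i : ℤ), zpow_mul,
        zpow_natCast]
    rw [h1, algebraMap_eq, coeff_C_mul, coeff_C_mul]
    ring
  have hQ0 : Q.eval 0 = 0 := by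
    have h1 := evalAt_smul hF 0 f
    rw [zero_pow hr.ne', zero_mul, zero_smul] at h1
    refine Eq.trans ?_ h1
    rw [hQ, evalAt]
    congr 2
    funext μ
    rw [Submodule.coe_zero, coeff_zero]
    refine Finset.sum_eq_zero fun m hm => ?_
    rw [zero_pow, mul_zero]
    have := hpos m hm
    omega
  have hQC : Q = Polynomial.C (evalAt F f) := by
    refine Polynomial.eq_of_infinite_eval_eq _ _
      ((Set.finite_singleton (0 : k)).infinite_compl.mono fun t ht => ?_)
    have ht0 : t ≠ 0 := ht
    change Q.eval t = _
    rw [hQt t ht0, Polynomial.eval_C]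
  rw [hQC, Polynomial.eval_C] at hQ0
  exact hne hQ0

theorem sum_apply_eq_of_mem_support {ι : Type*} [Fintype ι] {p : MvPolynomial ι k}
    (hp : p.IsHomogeneous e) {m : ι →₀ ℕ} (hm : m ∈ p.support) : ∑ i, m i = e := by
  rw [← Finsupp.degree_eq_sum]
  by_contra hne
  exact mem_support_iff.mp hm (hp.coeff_eq_zero hne)

theorem IsSemistable.isConcise [Infinite k] (he0 : 0 < e)
    (he : ∀ m : ℕ, 0 < m → m ≤ e → (m : k) ≠ 0) {f : Form k n e} (hf : IsSemistable f) :
    IsConcise f := by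
  intro W hW
  by_contra hne
  obtain ⟨C, hC⟩ := Submodule.exists_isCompl W
  let b := isComplBasis hC
  obtain ⟨p, hp, hpf⟩ := exists_aeval_basis b f.2
  have hpd : ∀ j, pderiv (Sum.inr j) p = 0 := fun j => by
    apply aeval_basis_injective b
    rw [← dirDeriv_coord_aeval, hpf, map_zero]
    exact dirDeriv_eq_zero_of_mem_symPow hW fun a ha => isComplBasis_coord_inr hC j ha
  have hC0 : 0 < Module.finrank k C := by
    rw [Nat.pos_iff_ne_zero]
    intro h0
    rw [Submodule.finrank_eq_zero.mp h0] at hC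
    exact hne (eq_top_of_isCompl_bot hC)
  -- Weight `dim C` on `W` and `-dim W` on `C` has total zero, while each monomial of `f ∈ Sym^e W`
  -- has weight `e · dim C > 0`.
  obtain ⟨m, hm, hle⟩ := hf.exists_weight_nonpos b
    (Sum.elim (fun _ => (Module.finrank k C : ℤ)) fun _ => -(Module.finrank k W : ℤ))
    (by simp [mul_comm]) hp hpf
  have hz : ∀ j, m (Sum.inr j) = 0 := fun j =>
    apply_eq_zero_of_pderiv_eq_zero he hp (hpd j) hm
  have hs := sum_apply_eq_of_mem_support hp hm
  rw [Fintype.sum_sum_type] at hs hle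
  simp only [hz, Finset.sum_const_zero, add_zero, Sum.elim_inl, Nat.cast_zero, zero_mul] at hs hle
  rw [← Finset.sum_mul, ← Nat.cast_sum, hs] at hle
  have : 0 < (e : ℤ) * (Module.finrank k C : ℤ) := by positivity
  omega

theorem IsSemistable.not_isLDS [Infinite k] {d : ℕ} (hd : 2 ≤ d) {f : Form k n (d + 1)}
    (hf : IsSemistable f) : ¬ IsLDS f := by
  classical
  rintro ⟨l, m, b, H, G, hl, hH, hG, hfe⟩
  have hinj : Function.Injective
      (fun i : Fin l => (Sum.inr (Sum.inl i) : Fin l ⊕ (Fin l ⊕ Fin m))) :=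
    Sum.inr_injective.comp Sum.inl_injective
  have hHd : ∀ i, (pderiv i H).IsHomogeneous d := fun i => by simpa using hH.pderiv (i := i)
  let p : MvPolynomial (Fin l ⊕ (Fin l ⊕ Fin m)) k := ∑ i, X (Sum.inl i) *
      rename (fun i : Fin l => (Sum.inr (Sum.inl i) : Fin l ⊕ (Fin l ⊕ Fin m))) (pderiv i H) +
      rename Sum.inr G
  have hp : p.IsHomogeneous (d + 1) := by
    refine (IsHomogeneous.sum _ _ _ fun i _ => ?_).add hG.rename_isHomogeneous
    rw [add_comm]
    exact (isHomogeneous_X k _).mul (hHd i).rename_isHomogeneous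
  have hpf : aeval (fun i => (b i : MvPolynomial (Fin n) k)) p = f := by
    rw [hfe]
    simp only [p, map_add, map_sum, map_mul, aeval_X, aeval_rename]
    rfl
  -- The weights sum to zero and are positive on `y` and `z`. A monomial with one `x` and `d ≥ 2`
  -- factors `y` has weight at least `l (m + 1) - m > 0`.
  let w : Fin l ⊕ (Fin l ⊕ Fin m) → ℤ := Sum.elim (fun _ => -((l : ℤ) * (m + 1) + m))
    (Sum.elim (fun _ => (l : ℤ) * (m + 1)) fun _ => (l : ℤ))
  obtain ⟨s, hs, hle⟩ := hf.exists_weight_nonpos b w (by simp [w]; ring) hp hpf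
  rw [Fintype.sum_sum_type, Fintype.sum_sum_type] at hle
  simp only [w, Sum.elim_inl, Sum.elim_inr, ← Finset.sum_mul, ← Nat.cast_sum] at hle
  have hl' : (1 : ℤ) ≤ l := by exact_mod_cast hl
  have hd' : (2 : ℤ) ≤ d := by exact_mod_cast hd
  rcases Finset.mem_union.mp (support_add hs) with h | h
  · obtain ⟨i, -, hi⟩ := Finset.mem_biUnion.mp (support_sum h)
    rw [support_X_mul, Finset.mem_map] at hi
    obtain ⟨s', hs', rfl⟩ := hi
    rw [support_rename_of_injective hinj, Finset.mem_image] at hs'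
    obtain ⟨q, hq, rfl⟩ := hs'
    have hqs := sum_apply_eq_of_mem_support (hHd i) hq
    have e1 : ∀ j, Finsupp.mapDomain
        (fun i : Fin l => (Sum.inr (Sum.inl i) : Fin l ⊕ (Fin l ⊕ Fin m))) q (Sum.inl j) = 0 :=
      fun j => Finsupp.mapDomain_of_notMem_range _ _ (by simp)
    have e2 : ∀ j, Finsupp.mapDomain
        (fun i : Fin l => (Sum.inr (Sum.inl i) : Fin l ⊕ (Fin l ⊕ Fin m))) q
          (Sum.inr (Sum.inl j)) = q j :=
      fun j => Finsupp.mapDomain_apply hinj _ _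
    have e3 : ∀ j, Finsupp.mapDomain
        (fun i : Fin l => (Sum.inr (Sum.inl i) : Fin l ⊕ (Fin l ⊕ Fin m))) q
          (Sum.inr (Sum.inr j)) = 0 :=
      fun j => Finsupp.mapDomain_of_notMem_range _ _ (by simp)
    simp [e1, e2, e3, Finsupp.single_apply] at hle
    have hqz : ∑ x, (q x : ℤ) = d := by exact_mod_cast hqs
    rw [hqz] at hle
    have hm' : (0 : ℤ) ≤ m := by positivity
    have h1 : (m : ℤ) + 1 ≤ l * (m + 1) := le_mul_of_one_le_left (by positivity) hl'
    have h2 : 2 * ((l : ℤ) * (m + 1)) ≤ d * (l * (m + 1)) :=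
      mul_le_mul_of_nonneg_right hd' (by positivity)
    linarith
  · rw [support_rename_of_injective Sum.inr_injective, Finset.mem_image] at h
    obtain ⟨q, hq, rfl⟩ := h
    have hqs := sum_apply_eq_of_mem_support hG hq
    rw [Fintype.sum_sum_type] at hqs
    simp only [Finsupp.mapDomain_apply Sum.inr_injective] at hle
    have e1 : ∀ j, Finsupp.mapDomain (Sum.inr : _ → Fin l ⊕ (Fin l ⊕ Fin m)) q (Sum.inl j) = 0 :=
      fun j => Finsupp.mapDomain_of_notMem_range _ _ (by simp)
    simp only [e1, Finset.sum_const_zero, Nat.cast_zero, zero_mul, zero_add] at hle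
    have h1 : (0 : ℤ) ≤ (∑ j, q (Sum.inl j) : ℕ) := by positivity
    have h2 : (0 : ℤ) ≤ (∑ j, q (Sum.inr j) : ℕ) := by positivity
    have h3 : ((∑ j, q (Sum.inl j) : ℕ) : ℤ) + (∑ j, q (Sum.inr j) : ℕ) = d + 1 := by
      exact_mod_cast hqs
    have h4 : (0 : ℤ) ≤ m := by positivity
    nlinarith [mul_nonneg (mul_nonneg h1 (by positivity : (0 : ℤ) ≤ l)) h4]

end Semistable

/-! ### Quadrics and the low-degree cases -/

section Quadric

variable {k : Type*} [Field k] {n : ℕ}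

/-- The Hessian is a constant symmetric bilinear form, nondegenerate by conciseness. As `2` is
invertible, some `u₀` is non-isotropic; the rank-one projection it defines onto the line of `g =
∂_{u₀} f` is self-adjoint, and is not the identity because `n ≥ 2`. -/
theorem IsConcise.isDirectSum_of_quadric (hn : 2 ≤ n)
    (he : ∀ m : ℕ, 0 < m → m ≤ 1 + 1 → (m : k) ≠ 0) {f : Form k n (1 + 1)} (hf : IsConcise f) :
    IsDirectSum f := by
  have hH : ∀ u v, dirDeriv u (dirDeriv v (f : MvPolynomial (Fin n) k)) = C (u (gradMap f v)) :=
    fun u v => by rw [← coe_gradMap, dirDeriv_linearForm]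
  have hsymm : ∀ u v : Module.Dual k (Form k n 1), u (gradMap f v) = v (gradMap f u) :=
    fun u v => by
      apply C_injective (Fin n) k
      rw [← hH, ← hH, dirDeriv_comm]
  obtain ⟨u₀, hu₀⟩ : ∃ u : Module.Dual k (Form k n 1), u (gradMap f u) ≠ 0 := by
    by_contra! h
    have h1 : ∀ u v : Module.Dual k (Form k n 1), u (gradMap f v) = 0 := fun u v => by
      have h2 := h (u + v)
      rw [map_add, LinearMap.add_apply, map_add, map_add, h u, h v, hsymm v u, zero_add, add_zero,
        ← two_mul] at h2
      exact (mul_eq_zero.mp h2).resolve_left (he 2 two_pos le_rfl)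
    have h3 : ∀ v : Module.Dual k (Form k n 1), v = 0 := fun v => by
      apply hf.gradMap_injective he
      rw [map_zero, ← Module.forall_dual_apply_eq_zero_iff k]
      exact fun u => h1 u v
    have h4 : Subsingleton (Module.Dual k (Form k n 1)) := ⟨fun a b => (h3 a).trans (h3 b).symm⟩
    have h5 := Module.finrank_zero_of_subsingleton (R := k) (M := Module.Dual k (Form k n 1))
    rw [Subspace.dual_finrank_eq, finrank_linearForm] at h5
    omega
  let g := gradMap f u₀
  let B : Module.End k (Form k n 1) := ((u₀ g)⁻¹ • u₀).smulRight g
  have hB : ∀ x, B x = ((u₀ g)⁻¹ * u₀ x) • g := fun x => rfl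
  have hBg : B g = g := by rw [hB, inv_mul_cancel₀ hu₀, one_smul]
  have hg0 : g ≠ 0 := fun h => hu₀ (by change u₀ g = 0; rw [h, map_zero])
  refine IsHessianSelfAdjoint.isDirectSum he hf (B := B) (fun u v => ?_) ?_ ?_ ?_
  · rw [hH, hH, hsymm u]
    simp only [LinearMap.comp_apply, hB, map_smul, smul_eq_mul]
    rw [hsymm u₀ v, hsymm u₀ u]
    change C (_ * _ * _) = C (_ * _ * _)
    congr 1
    simp only [g]
    ring
  · refine LinearMap.ext fun x => ?_
    change B (B x) = B x
    rw [hB x, map_smul, hBg]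
  · intro h
    rw [h] at hBg
    exact hg0 hBg.symm
  · intro h
    have h1 : (⊤ : Submodule k (Form k n 1)) ≤ Submodule.span k {g} := fun x _ => by
      have : B x = x := by rw [h]; rfl
      rw [← this, hB]
      exact Submodule.smul_mem _ _ (Submodule.mem_span_singleton_self g)
    have h2 := Submodule.finrank_mono h1
    rw [finrank_top, finrank_linearForm, finrank_span_singleton hg0] at h2
    omega

theorem IsSemistable.isDirectSum_of_or [Infinite k] (hn : 2 ≤ n) {d : ℕ}
    (he : ∀ m : ℕ, 0 < m → m ≤ d + 1 → (m : k) ≠ 0) {f : Form k n (d + 1)}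
    (hf : IsSemistable f) (h : IsDirectSum f ∨ IsLDS f) : IsDirectSum f := by
  refine h.elim id fun hl => ?_
  have hc := hf.isConcise (Nat.succ_pos d) he
  match d with
  | 0 =>
    -- A linear form lies in `Sym^1` of its own line, so conciseness would force `n = 1`.
    have h1 := hc (Submodule.span k {f}) (by
      rw [symPow, pow_one]
      exact ⟨f, Submodule.mem_span_singleton_self f, rfl⟩)
    have h2 := finrank_span_singleton (K := k) (hc.ne_zero (by omega))
    have h3 := congrArg (fun W : Submodule k (Form k n 1) => Module.finrank k W) h1
    simp only [finrank_top, finrank_linearForm] at h3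
    exact absurd (h2.symm.trans h3) (by omega)
  | 1 => exact hc.isDirectSum_of_quadric hn he
  | d + 2 => exact absurd hl (hf.not_isLDS (by omega))

end Quadric

end GradientMorphism

theorem theorem3p1 {k : Type*} [Field k] [IsAlgClosed k] (n d : ℕ) (hn : 2 ≤ n)
    (hchar : ¬ ringChar k ∣ (d + 1)!) (f : GradientMorphism.Form k n (d + 1)) :
    (GradientMorphism.IsConcise f →
      ∃ (hf₀ : f ≠ 0)
        (hf : Projectivization.mk k f hf₀ ∈ GradientMorphism.conciseLocus k n d),
        List.TFAE
          [GradientMorphism.IsDirectSum f ∨ GradientMorphism.IsLDS f,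
            GradientMorphism.NotInjectiveAt ⟨Projectivization.mk k f hf₀, hf⟩,
            GradientMorphism.PositiveFibreDimAt ⟨Projectivization.mk k f hf₀, hf⟩]) ∧
    (GradientMorphism.IsSemistable f →
      ∃ (hf₀ : f ≠ 0)
        (hf : Projectivization.mk k f hf₀ ∈ GradientMorphism.conciseLocus k n d),
        List.TFAE
          [GradientMorphism.IsDirectSum f,
            GradientMorphism.NotInjectiveAt ⟨Projectivization.mk k f hf₀, hf⟩,
            GradientMorphism.PositiveFibreDimAt ⟨Projectivization.mk k f hf₀, hf⟩]) := by
  have he : ∀ m : ℕ, 0 < m → m ≤ d + 1 → (m : k) ≠ 0 := fun m =>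
    GradientMorphism.natCast_ne_zero_of_ringChar_not_dvd hchar
  have hinf : Infinite k := IsAlgClosed.instInfinite
  have hn0 : 0 < n := by omega
  constructor
  · intro hf
    have hf₀ := hf.ne_zero hn0
    have hfc := (GradientMorphism.mk_mem_conciseLocus_iff f hf₀).mpr (hf.gradMap_injective he)
    exact ⟨hf₀, hfc, hf.tfae hn0 he hf₀ hfc⟩
  · intro hs
    have hf := hs.isConcise (Nat.succ_pos d) he
    have hf₀ := hf.ne_zero hn0
    have hfc := (GradientMorphism.mk_mem_conciseLocus_iff f hf₀).mpr (hf.gradMap_injective he)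
    refine ⟨hf₀, hfc, ?_⟩
    have h := hf.tfae hn0 he hf₀ hfc
    rwa [show (GradientMorphism.IsDirectSum f ∨ GradientMorphism.IsLDS f) =
      GradientMorphism.IsDirectSum f from
        propext ⟨hs.isDirectSum_of_or hn he, Or.inl⟩] at h
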